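/- Let $\mathbb E=\{x\in\mathbb C^3: 1-zx_1-wx_2+zwx_3\neq 0 \text{ whenever } |z|\le 1,|w|\le 1\}$ be the tetrablock and $b\mathbb E=\{x\in\mathbb C^3: x_1=\bar x_2x_3,\ |x_3|=1,\ |x_2|\le 1\}$ its distinguished boundary; $\sigma_T$ denotes the Taylor joint spectrum, $\omega$ the numerical radius and $[S,T]=ST-TS$. An $\mathbb E$-contraction is a commuting triple $(T_1,T_2,T_3)$ of bounded operators on a complex Hilbert space with $\sigma_T(T_1,T_2,T_3)\subseteq\overline{\mathbb E}$ and $\|p(T_1,T_2,T_3)\|\le\sup_{\overline{\mathbb E}}|p|$ for every polynomial $p$ in three variables; it is pure if $(T_3^*)^n\to 0$ strongly. Put $D_{T_3}=(I-T_3^*T_3)^{1/2}$ and $\mathcal D_{T_3}=\overline{\operatorname{Ran}}\,D_{T_3}$. The fundamental operators of $(T_1,T_2,T_3)$ are the bounded operators $A_1,A_2$ on $\mathcal D_{T_3}$ with $$T_1-T_2^*T_3=D_{T_3}A_1D_{T_3},\qquad T_2-T_1^*T_3=D_{T_3}A_2D_{T_3}.$$ A distinguished variety in $\mathbb E$ is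 a set $W\subseteq\mathbb E$ that is the intersection of $\mathbb E$ with the common zero set of a set of polynomials and satisfies $\overline W\cap\partial\mathbb E=\overline W\cap b\mathbb E$. **Theorem 6.1.** Let $\Upsilon=(T_1,T_2,T_3)$ be an $\mathbb E$-contraction on a nonzero complex Hilbert space such that $(T_1^*,T_2^*,T_3^*)$ is a pure $\mathbb E$-contraction and $\dim\mathcal D_{T_3}<\infty$. Suppose that the fundamental operators $A_1,A_2$ of $\Upsilon$ satisfy $[A_1,A_2]=0$ and $[A_1^*,A_1]=[A_2^*,A_2]$. Put $$\Omega_\Upsilon=\{x\in\overline{\mathbb E}:(x_1,x_2)\in\sigma_T(A_1^*+x_3A_2,\;A_2^*+x_3A_1)\},$$ $$\Omega_\Upsilon^*=\{x\in\overline{\mathbb E}:(x_1,x_2)\in\sigma_T(A_1+x_3A_2^*,\;A_2+x_3A_1^*)\}.$$ Then for every scalar or matrix-valued polynomial $p$ in three variables, $$\|p(T_1,T_2,T_3)\|\le\max_{x\in\Omega_\Upsilon^*\cap b\mathbb E}\|p(x)\|,$$ where the maximum exists (matrices carry the operator norm for Euclidean norms, block operators the operator norm for Hilbert direct sums). Moreover,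 if $\omega(A_1+A_2z)<1$ for every $z$ with $|z|=1$, then $\Omega_\Upsilon\cap\mathbb E$ and $\Omega_\Upsilon^*\cap\mathbb E$ are distinguished varieties in $\mathbb E$. -/

import Mathlib

open scoped Matrix.Norms.L2Operator

namespace Tetrablock

noncomputable section

/-! ### The tetrablock and its boundary -/

/-- The tetrablock `𝔼 ⊆ ℂ³`. The coordinates `x₁, x₂, x₃` are `x 0, x 1, x 2`. -/
def tetrablock : Set (Fin 3 → ℂ) :=
  {x | ∀ z w : ℂ, ‖z‖ ≤ 1 → ‖w‖ ≤ 1 → 1 - z * x 0 - w * x 1 + z * w * x 2 ≠ 0}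

/-- The distinguished boundary `b𝔼`. -/
def distBoundary : Set (Fin 3 → ℂ) :=
  {x | x 0 = star (x 1) * x 2 ∧ ‖x 2‖ = 1 ∧ ‖x 1‖ ≤ 1}

/-- `W` is a variety in the domain `G`: the part in `G` of the common zero set of a set of
polynomials. -/
def IsVarietyIn (W G : Set (Fin 3 → ℂ)) : Prop :=
  ∃ S : Set (MvPolynomial (Fin 3) ℂ), W = {x | ∀ p ∈ S, MvPolynomial.eval x p = 0} ∩ G

/-- A distinguished variety in the tetrablock: a variety in `𝔼` that leaves `𝔼` through the
distinguished boundary. -/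
def IsDistinguishedVariety (W : Set (Fin 3 → ℂ)) : Prop :=
  IsVarietyIn W tetrablock ∧
    closure W ∩ frontier tetrablock = closure W ∩ distBoundary

/-! ### Taylor joint spectra of pairs and triples -/

section Spectrum

variable {X : Type*} [NormedAddCommGroup X] [NormedSpace ℂ X]

/-- Exactness of the Koszul complex `0 → X → X² → X → 0` of the pair `(S₁, S₂)`, whose
differentials are `x ↦ (S₁ x, S₂ x)` and `(x₁, x₂) ↦ - S₂ x₁ + S₁ x₂`. -/
def TaylorRegularPair (S₁ S₂ : X →L[ℂ] X) : Prop :=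
  (∀ x : X, S₁ x = 0 → S₂ x = 0 → x = 0) ∧
  (∀ x₁ x₂ : X, -S₂ x₁ + S₁ x₂ = 0 → ∃ x : X, x₁ = S₁ x ∧ x₂ = S₂ x) ∧
  (∀ y : X, ∃ x₁ x₂ : X, -S₂ x₁ + S₁ x₂ = y)

/-- The Taylor joint spectrum of a commuting pair. -/
def taylorSpectrumPair (S₁ S₂ : X →L[ℂ] X) : Set (ℂ × ℂ) :=
  {l | ¬ TaylorRegularPair (S₁ - l.1 • ContinuousLinearMap.id ℂ X)
        (S₂ - l.2 • ContinuousLinearMap.id ℂ X)}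

/-- Exactness of the Koszul complex `0 → X → X³ → X³ → X → 0` of a triple. The differentials are
`x ↦ (Sᵢ x)ᵢ`, `(yᵢ)ᵢ ↦ (Sᵢ yⱼ - Sⱼ yᵢ)_{i<j}` and
`(z₀₁, z₀₂, z₁₂) ↦ S₀ z₁₂ - S₁ z₀₂ + S₂ z₀₁`. -/
def TaylorRegularTriple (S : Fin 3 → X →L[ℂ] X) : Prop :=
  (∀ x : X, S 0 x = 0 → S 1 x = 0 → S 2 x = 0 → x = 0) ∧
  (∀ y₀ y₁ y₂ : X, S 0 y₁ - S 1 y₀ = 0 → S 0 y₂ - S 2 y₀ = 0 → S 1 y₂ - S 2 y₁ = 0 →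
    ∃ x : X, y₀ = S 0 x ∧ y₁ = S 1 x ∧ y₂ = S 2 x) ∧
  (∀ z₀₁ z₀₂ z₁₂ : X, S 0 z₁₂ - S 1 z₀₂ + S 2 z₀₁ = 0 →
    ∃ y₀ y₁ y₂ : X, z₀₁ = S 0 y₁ - S 1 y₀ ∧ z₀₂ = S 0 y₂ - S 2 y₀ ∧
      z₁₂ = S 1 y₂ - S 2 y₁) ∧
  (∀ w : X, ∃ z₀₁ z₀₂ z₁₂ : X, S 0 z₁₂ - S 1 z₀₂ + S 2 z₀₁ = w)

/-- The Taylor joint spectrum of a commuting triple. -/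
def taylorSpectrumTriple (S : Fin 3 → X →L[ℂ] X) : Set (Fin 3 → ℂ) :=
  {l | ¬ TaylorRegularTriple fun i => S i - l i • ContinuousLinearMap.id ℂ X}

end Spectrum

/-! ### Polynomials in a commuting triple of operators -/

section Operators

variable {H : Type*} [NormedAddCommGroup H] [InnerProductSpace ℂ H]

/-- `p(T₁, T₂, T₃)` for a polynomial `p` and a commuting triple of operators. -/
def evalOp (p : MvPolynomial (Fin 3) ℂ) (T : Fin 3 → H →L[ℂ] H) : H →L[ℂ] H :=
  ∑ s ∈ p.support, p.coeff s • (T 0 ^ s 0 * T 1 ^ s 1 * T 2 ^ s 2)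

/-- The operator from the Hilbert space `Hⁿ` to the Hilbert space `Hᵐ` with block matrix `B`. -/
def blockOp {m n : ℕ} (B : Matrix (Fin m) (Fin n) (H →L[ℂ] H)) :
    PiLp 2 (fun _ : Fin n => H) →L[ℂ] PiLp 2 (fun _ : Fin m => H) :=
  (PiLp.continuousLinearEquiv 2 ℂ (fun _ : Fin m => H)).symm.toContinuousLinearMap ∘L
    ContinuousLinearMap.pi fun i => ∑ j, B i j ∘L PiLp.proj 2 (fun _ : Fin n => H) j

/-- `P(T₁, T₂, T₃)` for a matrix-valued polynomial `P`, as an operator from `Hⁿ` to `Hᵐ`. -/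
def evalMatrixOp {m n : ℕ} (P : Matrix (Fin m) (Fin n) (MvPolynomial (Fin 3) ℂ))
    (T : Fin 3 → H →L[ℂ] H) :
    PiLp 2 (fun _ : Fin n => H) →L[ℂ] PiLp 2 (fun _ : Fin m => H) :=
  blockOp (P.map fun p => evalOp p T)

/-- The value `P(x) ∈ ℂ^{m × n}` of a matrix-valued polynomial at a point. -/
def evalMatrix {m n : ℕ} (P : Matrix (Fin m) (Fin n) (MvPolynomial (Fin 3) ℂ))
    (x : Fin 3 → ℂ) : Matrix (Fin m) (Fin n) ℂ :=
  P.map (MvPolynomial.eval x)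

/-- The numerical radius `ω(A) = sup {|⟨A x, x⟩| : ‖x‖ = 1}`. -/
def numericalRadius (A : H →L[ℂ] H) : ℝ :=
  sSup ((fun x : H => ‖inner ℂ (A x) x‖) '' {x : H | ‖x‖ = 1})

/-- An `𝔼`-contraction: a commuting triple having the closed tetrablock as a spectral set. -/
structure IsEContraction (T : Fin 3 → H →L[ℂ] H) : Prop where
  commute : ∀ i j, Commute (T i) (T j)
  spectrum_subset : taylorSpectrumTriple T ⊆ closure tetrablock
  vonNeumann : ∀ p : MvPolynomial (Fin 3) ℂ,
    ‖evalOp p T‖ ≤ sSup ((fun x => ‖MvPolynomial.eval x p‖) '' closure tetrablock)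

variable [CompleteSpace H]

/-- The adjoint triple `(T₁*, T₂*, T₃*)`. -/
def adjointTriple (T : Fin 3 → H →L[ℂ] H) : Fin 3 → H →L[ℂ] H :=
  fun i => ContinuousLinearMap.adjoint (T i)

/-- A pure `𝔼`-contraction: `(T₃*)ⁿ → 0` strongly. -/
structure IsPureEContraction (T : Fin 3 → H →L[ℂ] H) : Prop extends IsEContraction T where
  pure_tendsto : ∀ h : H, Filter.Tendsto
    (fun n : ℕ => (ContinuousLinearMap.adjoint (T 2) ^ n) h) Filter.atTop (nhds 0)

/-- The defect operator `D_T = (I - T*T)^{1/2}` of a contraction. -/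
def defectOp (T : H →L[ℂ] H) : H →L[ℂ] H :=
  CFC.sqrt (1 - ContinuousLinearMap.adjoint T * T)

/-- The defect space `𝒟_T`, the closure of the range of `D_T`. -/
def defectSpace (T : H →L[ℂ] H) : Submodule ℂ H :=
  (LinearMap.range (defectOp T).toLinearMap).topologicalClosure

instance (T : H →L[ℂ] H) : CompleteSpace (defectSpace T) :=
  (Submodule.isClosed_topologicalClosure _).completeSpace_coe

/-- `D_T` as an operator from `H` to `𝒟_T`. -/
def defectMap (T : H →L[ℂ] H) : H →L[ℂ] defectSpace T :=
  (defectOp T).codRestrict (defectSpace T) fun x =>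
    Submodule.le_topologicalClosure _ (LinearMap.mem_range_self _ x)

/-- `A₁, A₂` on `𝒟_{T₃}` are the fundamental operators of `(T₁, T₂, T₃)`:
`T₁ - T₂*T₃ = D A₁ D` and `T₂ - T₁*T₃ = D A₂ D`, where `D = D_{T₃}`. -/
def IsFundamentalPair (T : Fin 3 → H →L[ℂ] H)
    (A₁ A₂ : defectSpace (T 2) →L[ℂ] defectSpace (T 2)) : Prop :=
  T 0 - ContinuousLinearMap.adjoint (T 1) * T 2 =
      defectOp (T 2) ∘L (defectSpace (T 2)).subtypeL ∘L A₁ ∘L defectMap (T 2) ∧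
  T 1 - ContinuousLinearMap.adjoint (T 0) * T 2 =
      defectOp (T 2) ∘L (defectSpace (T 2)).subtypeL ∘L A₂ ∘L defectMap (T 2)

/-- The subset `{x ∈ closure 𝔼 : (x₁, x₂) ∈ σ_T(A₁* + x₃ A₂, A₂* + x₃ A₁)}`. -/
def omegaSet (A₁ A₂ : H →L[ℂ] H) : Set (Fin 3 → ℂ) :=
  {x | x ∈ closure tetrablock ∧
    (x 0, x 1) ∈ taylorSpectrumPair (ContinuousLinearMap.adjoint A₁ + x 2 • A₂)
      (ContinuousLinearMap.adjoint A₂ + x 2 • A₁)}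

/-- The subset `{x ∈ closure 𝔼 : (x₁, x₂) ∈ σ_T(A₁ + x₃ A₂*, A₂ + x₃ A₁*)}`. -/
def omegaStarSet (A₁ A₂ : H →L[ℂ] H) : Set (Fin 3 → ℂ) :=
  {x | x ∈ closure tetrablock ∧
    (x 0, x 1) ∈ taylorSpectrumPair (A₁ + x 2 • ContinuousLinearMap.adjoint A₂)
      (A₂ + x 2 • ContinuousLinearMap.adjoint A₁)}

end Operators

end

end Tetrablock

namespace Tetrablock

/-! ### Geometry of the tetrablock -/

/-! Write `D` for the defect map of `T 2`, with values in the finite-dimensional space `K =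
defectSpace (T 2)`. The defining equations of `A₁, A₂` become the intertwining relations `D T₁ = A₁
D + A₂* D T₃` and `D T₂ = A₂ D + A₁* D T₃` (`IsFundamentalPair.defectMap_apply`). Since `‖D h‖² =
‖h‖² - ‖T₃ h‖²` and `T₃ⁿ → 0` strongly, the map `h ↦ (D T₃ⁿ h)ₙ` is an isometry into `ℓ²(K)`, and it
turns `T` into the restriction of `(A₁ + S A₂*, A₂ + S A₁*, S)` to an invariant subspace, `S` being
the backward shift. Polynomials in this model are bounded by their symbols on the unit circle. The
proof uses only finite sums: a long initial segment of the sequence is wrapped around a cyclic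
group, where the discrete Fourier transform diagonalizes translation (`sum_norm_sq_shift_le`).

For `|z| = 1` the two pencils commute (`commute_pencil`) and satisfy `A₁ + z A₂* = z (A₂ + z A₁*)*`,
so they are normal and share an orthonormal eigenbasis. The joint eigenvalues are points of `Ω* ∩
b𝔼` (`exists_orthonormalBasis_pencil`), so the symbol is bounded by the maximum there. That they lie
in the closed tetrablock rests on `|⟨A₁ u, u⟩| + |⟨A₂ u, u⟩| ≤ ‖u‖²`, which comes from the von
Neumann inequality for fractions `(x₁ - w x₃) / (1 - w x₂)`.

For the varieties, a unit joint eigenvector `u` at `x` gives `x₁ = β₁ + x₃ β̄₂` and `x₂ = β₂ + x₃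
β̄₁` with `βᵢ = ⟨Aᵢ u, u⟩`. The numerical radius condition makes `|β₁| + |β₂| < 1`, and then `|x₃| <
1` forces `x ∈ 𝔼` (`mem_tetrablock_of_norm_add_lt`). Hence a boundary point has `|x₃| = 1` and lies
in `b𝔼`. -/

lemma isOpen_tetrablock : IsOpen tetrablock := by
  have hK : IsCompact (Metric.closedBall (0 : ℂ) 1 ×ˢ Metric.closedBall (0 : ℂ) 1) :=
    (isCompact_closedBall _ _).prod (isCompact_closedBall _ _)
  have hcont : Continuous fun q : (Fin 3 → ℂ) × (ℂ × ℂ) =>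
      1 - q.2.1 * q.1 0 - q.2.2 * q.1 1 + q.2.1 * q.2.2 * q.1 2 := by fun_prop
  rw [isOpen_iff_mem_nhds]
  intro x hx
  have hopen : IsOpen {q : (Fin 3 → ℂ) × (ℂ × ℂ) |
      1 - q.2.1 * q.1 0 - q.2.2 * q.1 1 + q.2.1 * q.2.2 * q.1 2 ≠ 0} :=
    isOpen_ne_fun hcont continuous_const
  have h := hK.eventually_forall_of_forall_eventually (x₀ := x)
    (P := fun y q => 1 - q.1 * y 0 - q.2 * y 1 + q.1 * q.2 * y 2 ≠ 0) (by
      rintro ⟨z, w⟩ ⟨hz, hw⟩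
      exact hopen.mem_nhds (hx z w (by simpa using hz) (by simpa using hw)))
  filter_upwards [h] with y hy z w hz hw
  exact hy (z, w) ⟨by simpa using hz, by simpa using hw⟩

lemma swap_mem_tetrablock {x : Fin 3 → ℂ} (hx : x ∈ tetrablock) :
    ![x 1, x 0, x 2] ∈ tetrablock := by
  intro z w hz hw h
  refine hx w z hw hz ?_
  simp only [Matrix.cons_val] at h
  linear_combination h

/-- For fixed `w` the defining expression is affine in `z`. If the inequality failed, its root `(1 -
w x₂) / (x₁ - w x₃)` would lie in the closed disc. -/
lemma norm_sub_mul_lt_of_mem_tetrablock {x : Fin 3 → ℂ} (hx : x ∈ tetrablock) {w : ℂ}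
    (hw : ‖w‖ ≤ 1) : ‖x 0 - w * x 2‖ < ‖1 - w * x 1‖ := by
  by_contra! h
  by_cases h0 : x 0 - w * x 2 = 0
  · rw [h0, norm_zero] at h
    have h1 : 1 - w * x 1 = 0 := norm_le_zero_iff.1 h
    exact hx 0 w (by simp) hw (by linear_combination h1)
  · refine hx ((1 - w * x 1) / (x 0 - w * x 2)) w ?_ hw ?_
    · rw [norm_div]
      exact div_le_one_of_le₀ h (norm_nonneg _)
    · field_simp
      ring

lemma norm_snd_lt_one_of_mem_tetrablock {x : Fin 3 → ℂ} (hx : x ∈ tetrablock) : ‖x 1‖ < 1 := by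
  by_contra! h
  have h0 : x 1 ≠ 0 := by
    intro h0
    rw [h0, norm_zero] at h
    linarith
  refine hx 0 (x 1)⁻¹ (by simp) ?_ ?_
  · rw [norm_inv]
    exact inv_le_one_of_one_le₀ h
  · field_simp
    ring

lemma norm_third_lt_one_of_mem_tetrablock {x : Fin 3 → ℂ} (hx : x ∈ tetrablock) : ‖x 2‖ < 1 := by
  -- Square and add the previous estimate at `w = 1` and `w = -1`; the parallelogram law removes the
  -- cross terms. Adding the version with the first two coordinates swapped leaves only the third.
  have key : ∀ y ∈ tetrablock, ‖y 0‖ ^ 2 + ‖y 2‖ ^ 2 < 1 + ‖y 1‖ ^ 2 := by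
    intro y hy
    have h1 := norm_sub_mul_lt_of_mem_tetrablock hy (w := 1) (by simp)
    have h2 := norm_sub_mul_lt_of_mem_tetrablock hy (w := -1) (by simp)
    have p1 := parallelogram_law_with_norm ℝ (y 0) (y 2)
    have p2 := parallelogram_law_with_norm ℝ (1 : ℂ) (y 1)
    simp only [one_mul, neg_mul, sub_neg_eq_add, norm_one] at h1 h2 p2
    nlinarith [norm_nonneg (y 0 - y 2), norm_nonneg (y 0 + y 2)]
  have h1 := key x hx
  have h2 := key _ (swap_mem_tetrablock hx)
  simp only [Matrix.cons_val] at h2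
  nlinarith [norm_nonneg (x 2)]

lemma closure_tetrablock_subset {P : (Fin 3 → ℂ) → Prop} (hP : IsClosed {x | P x})
    (h : ∀ x ∈ tetrablock, P x) : ∀ x ∈ closure tetrablock, P x :=
  fun _ hx => closure_minimal (t := {x | P x}) h hP hx

lemma norm_le_one_of_mem_closure {x : Fin 3 → ℂ} (hx : x ∈ closure tetrablock) (i : Fin 3) :
    ‖x i‖ ≤ 1 := by
  refine closure_tetrablock_subset (P := fun x => ‖x i‖ ≤ 1)
    (isClosed_le (by fun_prop) (by fun_prop)) (fun x hx => ?_) x hx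
  fin_cases i
  · simpa using (norm_snd_lt_one_of_mem_tetrablock (swap_mem_tetrablock hx)).le
  · exact (norm_snd_lt_one_of_mem_tetrablock hx).le
  · exact (norm_third_lt_one_of_mem_tetrablock hx).le

lemma norm_sub_mul_le_of_mem_closure {x : Fin 3 → ℂ} (hx : x ∈ closure tetrablock) {w : ℂ}
    (hw : ‖w‖ ≤ 1) : ‖x 0 - w * x 2‖ ≤ ‖1 - w * x 1‖ ∧ ‖x 1 - w * x 2‖ ≤ ‖1 - w * x 0‖ := by
  refine closure_tetrablock_subset
    (P := fun x => ‖x 0 - w * x 2‖ ≤ ‖1 - w * x 1‖ ∧ ‖x 1 - w * x 2‖ ≤ ‖1 - w * x 0‖)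
    ?_ (fun x hx => ?_) x hx
  · rw [Set.ofPred_and]
    exact (isClosed_le (by fun_prop) (by fun_prop)).inter
      (isClosed_le (by fun_prop) (by fun_prop))
  exact ⟨(norm_sub_mul_lt_of_mem_tetrablock hx hw).le,
    (norm_sub_mul_lt_of_mem_tetrablock (swap_mem_tetrablock hx) hw).le⟩

lemma real_bidisc_inequality {b₁ b₂ s t : ℝ} (hb₁ : 0 ≤ b₁) (hb₂ : 0 ≤ b₂) (hb : b₁ + b₂ ≤ 1)
    (hs : 0 ≤ s) (hs1 : s ≤ 1) (ht : 0 ≤ t) (ht1 : t ≤ 1) :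
    0 ≤ 1 - s ^ 2 * t ^ 2 + (s ^ 2 - t ^ 2) * (b₁ ^ 2 - b₂ ^ 2) - 2 * s * b₁ * (1 - t ^ 2)
      - 2 * t * b₂ * (1 - s ^ 2) := by
  -- the expression decreases in `b₁`, and is explicitly nonnegative when `b₁ = 1 - b₂`
  have h1 : 0 ≤ (1 - b₂) * ((1 - t ^ 2) * (1 - s) ^ 2) + b₂ * ((1 - s ^ 2) * (1 - t) ^ 2) := by
    have : 0 ≤ 1 - t ^ 2 := by nlinarith
    have : 0 ≤ 1 - s ^ 2 := by nlinarith
    have : 0 ≤ 1 - b₂ := by linarith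
    positivity
  -- The value at `b₁` minus the value at `1 - b₂` is `1 - b₂ - b₁` times the difference of the two
  -- sides here.
  have h2 : (s ^ 2 - t ^ 2) * (1 - b₂ + b₁) ≤ 2 * s * (1 - t ^ 2) := by
    have h3 : s ^ 2 - t ^ 2 ≤ s * (1 - t ^ 2) := by
      nlinarith [mul_nonneg (sub_nonneg.2 hs1) hs, mul_nonneg (sub_nonneg.2 hs1) (sq_nonneg t)]
    have h4 : 0 ≤ s * (1 - t ^ 2) := mul_nonneg hs (by nlinarith)
    rcases le_total 0 (s ^ 2 - t ^ 2) with h | h <;> nlinarith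
  nlinarith [mul_nonneg (sub_nonneg.2 h2) (by linarith : 0 ≤ 1 - b₂ - b₁)]

/-- In the difference of squares the phases enter only through the real parts of `z β₁` and `w β₂`,
with nonpositive coefficients, so bounding these by moduli reduces to real numbers. -/
lemma norm_bidisc_inequality {β₁ β₂ z w : ℂ} (hβ : ‖β₁‖ + ‖β₂‖ ≤ 1) (hz : ‖z‖ ≤ 1)
    (hw : ‖w‖ ≤ 1) :
    ‖z * w - z * star β₂ - w * star β₁‖ ≤ ‖1 - z * β₁ - w * β₂‖ := by
  have key := real_bidisc_inequality (norm_nonneg β₁) (norm_nonneg β₂) hβ (norm_nonneg z) hz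
    (norm_nonneg w) hw
  have r1 : (z * β₁).re ≤ ‖z‖ * ‖β₁‖ := (Complex.re_le_norm _).trans (norm_mul_le _ _)
  have r2 : (w * β₂).re ≤ ‖w‖ * ‖β₂‖ := (Complex.re_le_norm _).trans (norm_mul_le _ _)
  have hz2 : 0 ≤ 1 - ‖z‖ ^ 2 := by nlinarith [norm_nonneg z]
  have hw2 : 0 ≤ 1 - ‖w‖ ^ 2 := by nlinarith [norm_nonneg w]
  have m1 := mul_le_mul_of_nonneg_right r1 hw2
  have m2 := mul_le_mul_of_nonneg_right r2 hz2
  refine le_of_sq_le_sq ?_ (norm_nonneg _)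
  have e : ‖1 - z * β₁ - w * β₂‖ ^ 2 - ‖z * w - z * star β₂ - w * star β₁‖ ^ 2 =
      1 - ‖z‖ ^ 2 * ‖w‖ ^ 2 + (‖z‖ ^ 2 - ‖w‖ ^ 2) * (‖β₁‖ ^ 2 - ‖β₂‖ ^ 2)
      - 2 * ((z * β₁).re * (1 - ‖w‖ ^ 2)) - 2 * ((w * β₂).re * (1 - ‖z‖ ^ 2)) := by
    simp only [← Complex.normSq_eq_norm_sq, Complex.normSq_apply, Complex.sub_re, Complex.sub_im,
      Complex.mul_re, Complex.mul_im, Complex.one_re, Complex.one_im, Complex.star_def,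
      Complex.conj_re, Complex.conj_im]
    ring
  nlinarith

/-- The defining expression equals `(1 - z β₁ - w β₂) + x₃ (zw - z β̄₂ - w β̄₁)`; the second bracket
is dominated by the nonzero first one, and `|x₃| < 1`. -/
lemma mem_tetrablock_of_norm_add_lt {x : Fin 3 → ℂ} {β₁ β₂ : ℂ} (hβ : ‖β₁‖ + ‖β₂‖ < 1)
    (hx : ‖x 2‖ < 1) (h0 : x 0 = β₁ + x 2 * star β₂) (h1 : x 1 = β₂ + x 2 * star β₁) :
    x ∈ tetrablock := by
  intro z w hz hw h
  have hle := norm_bidisc_inequality hβ.le hz hw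
  have hpos : 0 < ‖1 - z * β₁ - w * β₂‖ := by
    have : ‖z * β₁ + w * β₂‖ < 1 := by
      refine (norm_add_le _ _).trans_lt ?_
      rw [norm_mul, norm_mul]
      nlinarith [norm_nonneg β₁, norm_nonneg β₂]
    have h2 := norm_sub_norm_le (1 : ℂ) (z * β₁ + w * β₂)
    rw [norm_one, ← sub_sub] at h2
    linarith
  have heq : 1 - z * β₁ - w * β₂ = - (x 2 * (z * w - z * star β₂ - w * star β₁)) := by
    rw [h0, h1] at h
    linear_combination h
  have hn : ‖1 - z * β₁ - w * β₂‖ = ‖x 2‖ * ‖z * w - z * star β₂ - w * star β₁‖ := by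
    rw [heq, norm_neg, norm_mul]
  nlinarith [norm_nonneg (x 2)]

lemma distBoundary_subset_closure : distBoundary ⊆ closure tetrablock := by
  rintro x ⟨h0, h2, h1⟩
  -- A path ending at `x` at `r = 1`; for `r < 1` it lies in the tetrablock, with parameters `β₁ =
  -- 0` and `β₂ = r x₂`.
  let f : ℝ → Fin 3 → ℂ := fun r => ![(r * x 2) * star (r * x 1), r * x 1, r * x 2]
  have hf : Continuous f := by
    refine continuous_pi fun i => ?_
    fin_cases i <;> simp only [f, Fin.zero_eta, Fin.mk_one, Fin.reduceFinMk, Matrix.cons_val] <;>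
      fun_prop
  have hf1 : f 1 = x := by
    ext i
    fin_cases i <;> simp [f, h0, mul_comm]
  have hmem : ∀ r ∈ Set.Ico (0 : ℝ) 1, f r ∈ tetrablock := by
    rintro r ⟨hr0, hr1⟩
    refine mem_tetrablock_of_norm_add_lt (β₁ := 0) (β₂ := r * x 1) ?_ ?_ ?_ ?_
    · rw [norm_zero, zero_add, norm_mul, Complex.norm_real, Real.norm_of_nonneg hr0]
      nlinarith [norm_nonneg (x 1)]
    · simp only [f, Matrix.cons_val]
      rw [norm_mul, Complex.norm_real, Real.norm_of_nonneg hr0, h2]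
      linarith
    · simp [f]
    · simp [f]
  have h1' : (1 : ℝ) ∈ closure (Set.Ico (0 : ℝ) 1) := by
    rw [closure_Ico (by norm_num)]
    simp
  have := hf.continuousOn.image_closure (s := Set.Ico (0 : ℝ) 1) ⟨1, h1', hf1⟩
  exact closure_mono (Set.image_subset_iff.2 (show _ ⊆ f ⁻¹' tetrablock from hmem)) this

lemma mem_distBoundary_of_norm_third_eq_one {x : Fin 3 → ℂ} {β₁ β₂ : ℂ}
    (h0 : x 0 = β₁ + x 2 * star β₂) (h1 : x 1 = β₂ + x 2 * star β₁)
    (hx : ‖x 2‖ = 1) (hle : ‖x 1‖ ≤ 1) : x ∈ distBoundary := by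
  refine ⟨?_, hx, hle⟩
  have hz : x 2 * star (x 2) = 1 := by
    rw [Complex.star_def, Complex.mul_conj, Complex.normSq_eq_norm_sq, hx]
    simp
  rw [h0, h1, star_add, star_mul', star_star]
  linear_combination (-β₁) * hz

lemma isClosed_distBoundary : IsClosed distBoundary := by
  rw [distBoundary, Set.ofPred_and, Set.ofPred_and]
  refine (isClosed_eq ?_ ?_).inter ((isClosed_eq ?_ ?_).inter (isClosed_le ?_ ?_)) <;> fun_prop

/-! ### The von Neumann inequality and the numerical range of the fundamental operators -/

section VonNeumann

variable {H : Type*} [NormedAddCommGroup H] [InnerProductSpace ℂ H]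

lemma exists_algHom_eq_evalOp {T : Fin 3 → H →L[ℂ] H} (hT : ∀ i j, Commute (T i) (T j)) :
    ∃ φ : MvPolynomial (Fin 3) ℂ →ₐ[ℂ] (H →L[ℂ] H),
      (∀ p, φ p = evalOp p T) ∧ ∀ i, φ (MvPolynomial.X i) = T i := by
  let 𝒞 := Algebra.adjoin ℂ (Set.range T)
  have hC : IsMulCommutative 𝒞 := Algebra.isMulCommutative_adjoin ℂ (by
    rintro _ ⟨i, rfl⟩ _ ⟨j, rfl⟩
    exact hT i j)
  let : CommRing 𝒞 := { (inferInstance : Ring 𝒞) with mul_comm := hC.is_comm.comm }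
  let t : Fin 3 → 𝒞 := fun i => ⟨T i, Algebra.subset_adjoin ⟨i, rfl⟩⟩
  refine ⟨𝒞.val.comp (MvPolynomial.aeval t), fun p => ?_, fun i => ?_⟩
  · rw [AlgHom.comp_apply, MvPolynomial.aeval_def, MvPolynomial.eval₂_eq', map_sum, evalOp]
    refine Finset.sum_congr rfl fun s _ => ?_
    rw [Fin.prod_univ_three, ← Algebra.smul_def]
    simp [t]
  · simp [t]

variable {T : Fin 3 → H →L[ℂ] H}

lemma IsEContraction.norm_evalOp_le (hT : IsEContraction T) (p : MvPolynomial (Fin 3) ℂ) {M : ℝ}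
    (hM : 0 ≤ M) (h : ∀ x ∈ closure tetrablock, ‖MvPolynomial.eval x p‖ ≤ M) :
    ‖evalOp p T‖ ≤ M := by
  refine (hT.vonNeumann p).trans (Real.sSup_le ?_ hM)
  rintro _ ⟨x, hx, rfl⟩
  exact h x hx

lemma IsEContraction.norm_le_one (hT : IsEContraction T) (i : Fin 3) : ‖T i‖ ≤ 1 := by
  obtain ⟨φ, hφ, hX⟩ := exists_algHom_eq_evalOp hT.commute
  rw [← hX, hφ]
  refine hT.norm_evalOp_le _ zero_le_one fun x hx => ?_
  simpa using norm_le_one_of_mem_closure hx i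

/-- The von Neumann inequality for `(xᵢ - w x₃) / (1 - w xⱼ)`, a function bounded by one. For `|w| <
1` the fraction is replaced by polynomials from partial geometric sums; `|w| = 1` follows by
continuity. -/
lemma IsEContraction.norm_sub_smul_apply_le (hT : IsEContraction T) {i j : Fin 3}
    (hij : ∀ x ∈ closure tetrablock, ∀ w : ℂ, ‖w‖ ≤ 1 → ‖x i - w * x 2‖ ≤ ‖1 - w * x j‖)
    {w : ℂ} (hw : ‖w‖ ≤ 1) (h : H) : ‖T i h - w • T 2 h‖ ≤ ‖h - w • T j h‖ := by
  obtain ⟨φ, hφ, hX⟩ := exists_algHom_eq_evalOp hT.commute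
  have hlt : ∀ w : ℂ, ‖w‖ < 1 → ‖T i h - w • T 2 h‖ ≤ ‖h - w • T j h‖ := by
    intro w hw
    let q : MvPolynomial (Fin 3) ℂ := MvPolynomial.C w * MvPolynomial.X j
    let f : ℕ → MvPolynomial (Fin 3) ℂ := fun N =>
      (MvPolynomial.X i - MvPolynomial.C w * MvPolynomial.X 2) * ∑ k ∈ Finset.range N, q ^ k
    have hf : ∀ N, f N * (1 - q) =
        (MvPolynomial.X i - MvPolynomial.C w * MvPolynomial.X 2) * (1 - q ^ N) := fun N => by
      rw [mul_assoc, geom_sum_mul_neg]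
    have hqx : ∀ x : Fin 3 → ℂ, MvPolynomial.eval x q = w * x j := fun x => by simp [q]
    -- Truncating the geometric series after `N` terms multiplies the fraction by `1 - (w xⱼ)^N`,
    -- which accounts for the extra `‖w‖ ^ N`.
    have hbound : ∀ N, ‖evalOp (f N) T‖ ≤ 1 + ‖w‖ ^ N := by
      intro N
      refine hT.norm_evalOp_le _ (by positivity) fun x hx => ?_
      have h1 := congrArg (fun p => ‖MvPolynomial.eval x p‖) (hf N)
      simp only [map_mul, map_sub, map_one, map_pow, hqx, MvPolynomial.eval_X,
        MvPolynomial.eval_C, norm_mul] at h1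
      have hwx : ‖w * x j‖ < 1 := by
        rw [norm_mul]
        nlinarith [norm_le_one_of_mem_closure hx j, norm_nonneg (x j), norm_nonneg w]
      have hpos : 0 < ‖1 - w * x j‖ := by
        have := norm_sub_norm_le (1 : ℂ) (w * x j)
        rw [norm_one] at this
        linarith
      have h2 : ‖1 - (w * x j) ^ N‖ ≤ 1 + ‖w‖ ^ N := by
        refine (norm_sub_le _ _).trans ?_
        rw [norm_one, norm_pow, norm_mul]
        gcongr
        exact mul_le_of_le_one_right (norm_nonneg _) (norm_le_one_of_mem_closure hx j)
      have h3 := mul_le_mul (hij x hx w hw.le) h2 (norm_nonneg _) hpos.le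
      rw [← h1, mul_comm] at h3
      exact le_of_mul_le_mul_left h3 hpos
    have hφq : φ q = w • T j := by
      rw [map_mul, hX, ← MvPolynomial.algebraMap_eq, AlgHom.commutes, Algebra.algebraMap_eq_smul_one,
        smul_mul_assoc, one_mul]
    have hφi : φ (MvPolynomial.X i - MvPolynomial.C w * MvPolynomial.X 2) = T i - w • T 2 := by
      rw [map_sub, map_mul, hX, hX, ← MvPolynomial.algebraMap_eq, AlgHom.commutes,
        Algebra.algebraMap_eq_smul_one, smul_mul_assoc, one_mul]
    have hle : ∀ N, ‖(T i - w • T 2) (h - ((w • T j) ^ N) h)‖ ≤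
        (1 + ‖w‖ ^ N) * ‖h - w • T j h‖ := by
      intro N
      have h1 := congrArg (fun p => φ p h) (hf N)
      simp only [map_mul, map_sub φ 1, map_one, map_pow, hφq, hφi] at h1
      have h2 : (T i - w • T 2) (h - ((w • T j) ^ N) h) = evalOp (f N) T (h - w • T j h) := by
        rw [← hφ]
        exact h1.symm
      rw [h2]
      exact (ContinuousLinearMap.le_opNorm _ _).trans
        (mul_le_mul_of_nonneg_right (hbound N) (norm_nonneg _))
    have hpow : Filter.Tendsto (fun N => ((w • T j) ^ N) h) Filter.atTop (nhds 0) := by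
      have hn : ‖w • T j‖ < 1 := by
        rw [norm_smul]
        nlinarith [hT.norm_le_one j, norm_nonneg (T j), norm_nonneg w]
      have := tendsto_pow_atTop_nhds_zero_of_norm_lt_one hn
      exact ((ContinuousLinearMap.apply ℂ H h).continuous.tendsto 0).comp this
    have l1 : Filter.Tendsto (fun N => ‖(T i - w • T 2) (h - ((w • T j) ^ N) h)‖) Filter.atTop
        (nhds ‖(T i - w • T 2) (h - 0)‖) :=
      (((T i - w • T 2).continuous.tendsto _).comp (tendsto_const_nhds.sub hpow)).norm
    have l2 : Filter.Tendsto (fun N => (1 + ‖w‖ ^ N) * ‖h - w • T j h‖) Filter.atTop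
        (nhds ((1 + 0) * ‖h - w • T j h‖)) :=
      (tendsto_const_nhds.add
        (tendsto_pow_atTop_nhds_zero_of_lt_one (norm_nonneg _) hw)).mul_const _
    simpa using le_of_tendsto_of_tendsto' l1 l2 hle
  have hcl : IsClosed {w : ℂ | ‖T i h - w • T 2 h‖ ≤ ‖h - w • T j h‖} :=
    isClosed_le (by fun_prop) (by fun_prop)
  have hball : w ∈ closure (Metric.ball (0 : ℂ) 1) := by
    rw [closure_ball _ one_ne_zero]
    simpa using hw
  exact closure_minimal (fun w hw => hlt w (by simpa using hw)) hcl hball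

end VonNeumann

section Fundamental

variable {H : Type*} [NormedAddCommGroup H] [InnerProductSpace ℂ H] [CompleteSpace H]

lemma defectOp_isSelfAdjoint (S : H →L[ℂ] H) : IsSelfAdjoint (defectOp S) :=
  (CFC.sqrt_nonneg _).isSelfAdjoint

lemma one_sub_adjoint_mul_self_nonneg {S : H →L[ℂ] H} (hS : ‖S‖ ≤ 1) :
    0 ≤ 1 - ContinuousLinearMap.adjoint S * S := by
  rw [ContinuousLinearMap.nonneg_iff_isPositive, ContinuousLinearMap.isPositive_iff_complex]
  intro x
  have h1 : inner ℂ ((1 - ContinuousLinearMap.adjoint S * S) x) x =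
      ((‖x‖ ^ 2 - ‖S x‖ ^ 2 : ℝ) : ℂ) := by
    rw [sub_apply, inner_sub_left, one_apply_eq_self,
      mul_apply_eq_comp, ContinuousLinearMap.adjoint_inner_left,
      inner_self_eq_norm_sq_to_K, inner_self_eq_norm_sq_to_K]
    push_cast
    rfl
  rw [h1]
  refine ⟨rfl, ?_⟩
  rw [RCLike.re_eq_complex_re, Complex.ofReal_re, sub_nonneg]
  exact pow_le_pow_left₀ (norm_nonneg _) (S.le_of_opNorm_le hS x |>.trans_eq (one_mul _)) 2

lemma defectOp_mul_self {S : H →L[ℂ] H} (hS : ‖S‖ ≤ 1) :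
    defectOp S * defectOp S = 1 - ContinuousLinearMap.adjoint S * S :=
  CFC.sqrt_mul_sqrt_self _ (one_sub_adjoint_mul_self_nonneg hS)

lemma inner_defectMap (S : H →L[ℂ] H) (d : defectSpace S) (h : H) :
    inner ℂ d (defectMap S h) = inner ℂ (defectOp S (d : H)) h := by
  rw [← ContinuousLinearMap.adjoint_inner_right, (defectOp_isSelfAdjoint S).adjoint_eq]
  rfl

lemma norm_defectMap_sq {S : H →L[ℂ] H} (hS : ‖S‖ ≤ 1) (h : H) :
    ‖defectMap S h‖ ^ 2 = ‖h‖ ^ 2 - ‖S h‖ ^ 2 := by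
  have h1 : inner ℂ (defectMap S h) (defectMap S h) =
      inner ℂ ((defectOp S * defectOp S) h) h := inner_defectMap S _ h
  rw [defectOp_mul_self hS] at h1
  have h2 : inner ℂ ((1 - ContinuousLinearMap.adjoint S * S) h) h =
      inner ℂ h h - inner ℂ (S h) (S h) := by
    simp [ContinuousLinearMap.adjoint_inner_left]
  rw [h2] at h1
  simp only [inner_self_eq_norm_sq_to_K] at h1
  exact_mod_cast h1

lemma denseRange_defectMap (S : H →L[ℂ] H) : DenseRange (defectMap S) := by
  intro d
  rw [closure_subtype]
  have hd : (d : H) ∈ closure (LinearMap.range (defectOp S).toLinearMap : Set H) := d.2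
  convert hd using 2
  ext y
  constructor
  · rintro ⟨_, ⟨h, rfl⟩, rfl⟩
    exact ⟨h, rfl⟩
  · rintro ⟨h, rfl⟩
    exact ⟨_, ⟨h, rfl⟩, rfl⟩

lemma eq_of_forall_inner_defectMap_eq {S : H →L[ℂ] H} {d e : defectSpace S}
    (h : ∀ k, inner ℂ d (defectMap S k) = inner ℂ e (defectMap S k)) : d = e :=
  ext_inner_right ℂ fun y => (denseRange_defectMap S).induction_on y
    (isClosed_eq (by fun_prop) (by fun_prop)) h

variable {T : Fin 3 → H →L[ℂ] H} {A₁ A₂ : defectSpace (T 2) →L[ℂ] defectSpace (T 2)}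

lemma IsFundamentalPair.apply_fst (hA : IsFundamentalPair T A₁ A₂) (h : H) :
    T 0 h - ContinuousLinearMap.adjoint (T 1) (T 2 h) =
      defectOp (T 2) (A₁ (defectMap (T 2) h) : H) :=
  congrArg (fun S => S h) hA.1

lemma IsFundamentalPair.apply_snd (hA : IsFundamentalPair T A₁ A₂) (h : H) :
    T 1 h - ContinuousLinearMap.adjoint (T 0) (T 2 h) =
      defectOp (T 2) (A₂ (defectMap (T 2) h) : H) :=
  congrArg (fun S => S h) hA.2

lemma IsFundamentalPair.inner_fst (hA : IsFundamentalPair T A₁ A₂) (h k : H) :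
    inner ℂ (A₁ (defectMap (T 2) h)) (defectMap (T 2) k) =
      inner ℂ (T 0 h) k - inner ℂ (T 2 h) (T 1 k) := by
  rw [inner_defectMap, ← hA.apply_fst, inner_sub_left, ContinuousLinearMap.adjoint_inner_left]

lemma IsFundamentalPair.inner_snd (hA : IsFundamentalPair T A₁ A₂) (h k : H) :
    inner ℂ (A₂ (defectMap (T 2) h)) (defectMap (T 2) k) =
      inner ℂ (T 1 h) k - inner ℂ (T 2 h) (T 0 k) := by
  rw [inner_defectMap, ← hA.apply_snd, inner_sub_left, ContinuousLinearMap.adjoint_inner_left]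

/-- For a commuting triple, `D T₁ = A₁ D + A₂* D T₃` and `D T₂ = A₂ D + A₁* D T₃`. -/
lemma IsFundamentalPair.defectMap_apply (hA : IsFundamentalPair T A₁ A₂)
    (hT : ∀ i j, Commute (T i) (T j)) (hT3 : ‖T 2‖ ≤ 1) (h : H) :
    defectMap (T 2) (T 0 h) = A₁ (defectMap (T 2) h) +
        ContinuousLinearMap.adjoint A₂ (defectMap (T 2) (T 2 h)) ∧
    defectMap (T 2) (T 1 h) = A₂ (defectMap (T 2) h) +
        ContinuousLinearMap.adjoint A₁ (defectMap (T 2) (T 2 h)) := by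
  have hc : ∀ i j x, T i (T j x) = T j (T i x) := fun i j x =>
    congrArg (fun S => S x) (hT i j).eq
  have hD : ∀ x y, inner ℂ (defectMap (T 2) x) (defectMap (T 2) y) =
      inner ℂ x y - inner ℂ (T 2 x) (T 2 y) := by
    intro x y
    have h1 : inner ℂ (defectMap (T 2) x) (defectMap (T 2) y) =
        inner ℂ ((defectOp (T 2) * defectOp (T 2)) x) y := inner_defectMap _ _ y
    rw [h1, defectOp_mul_self hT3]
    simp [ContinuousLinearMap.adjoint_inner_left]
  constructor
  -- Tested against the dense range of `D`, both sides become inner products of the `T i`; the mixed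
  -- terms `⟨T₃ h, T₂ k⟩` cancel, and commutativity matches the rest.
  · refine eq_of_forall_inner_defectMap_eq fun k => ?_
    rw [hD, inner_add_left, hA.inner_fst, ContinuousLinearMap.adjoint_inner_left,
      ← inner_conj_symm (defectMap (T 2) (T 2 h)), hA.inner_snd, map_sub, inner_conj_symm,
      inner_conj_symm, hc 0 2]
    ring
  · refine eq_of_forall_inner_defectMap_eq fun k => ?_
    rw [hD, inner_add_left, hA.inner_snd, ContinuousLinearMap.adjoint_inner_left,
      ← inner_conj_symm (defectMap (T 2) (T 2 h)), hA.inner_fst, map_sub, inner_conj_symm,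
      inner_conj_symm, hc 1 2]
    ring

lemma exists_norm_one_mul_eq_norm (a : ℂ) : ∃ z : ℂ, ‖z‖ = 1 ∧ z * a = ‖a‖ := by
  by_cases ha : a = 0
  · exact ⟨1, by simp, by simp [ha]⟩
  · have hn : (‖a‖ : ℂ) ≠ 0 := by simpa using ha
    refine ⟨‖a‖ / a, ?_, ?_⟩
    · rw [norm_div, Complex.norm_real, norm_norm, div_self (by simpa using ha)]
    · field_simp

/-- The fundamental operators satisfy `|⟨A₁ d, d⟩| + |⟨A₂ d, d⟩| ≤ ‖d‖²`. -/
lemma IsFundamentalPair.norm_inner_add_norm_inner_le (hA : IsFundamentalPair T A₁ A₂)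
    (hT : IsEContraction T) (d : defectSpace (T 2)) :
    ‖inner ℂ (A₁ d) d‖ + ‖inner ℂ (A₂ d) d‖ ≤ ‖d‖ ^ 2 := by
  have hcl : IsClosed {d : defectSpace (T 2) |
      ‖inner ℂ (A₁ d) d‖ + ‖inner ℂ (A₂ d) d‖ ≤ ‖d‖ ^ 2} :=
    isClosed_le (by fun_prop) (by fun_prop)
  refine (denseRange_defectMap (T 2)).induction_on d hcl fun h => ?_
  rw [norm_defectMap_sq (hT.norm_le_one 2), hA.inner_fst, hA.inner_snd]
  obtain ⟨z, hz, hza⟩ := exists_norm_one_mul_eq_norm (inner ℂ (T 0 h) h - inner ℂ (T 2 h) (T 1 h))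
  obtain ⟨w, hw, hwa⟩ := exists_norm_one_mul_eq_norm (inner ℂ (T 1 h) h - inner ℂ (T 2 h) (T 0 h))
  -- Once `h1` and `h2` are squared and added, `‖T₁ h‖²` and `‖T₂ h‖²` cancel. The phases `z, w`
  -- turn the remaining real parts into the two moduli.
  have h1 := hT.norm_sub_smul_apply_le (i := 0) (j := 1)
    (fun x hx w hw => (norm_sub_mul_le_of_mem_closure hx hw).1) (w := star w) (by simp [hw]) h
  have h2 := hT.norm_sub_smul_apply_le (i := 1) (j := 0)
    (fun x hx w hw => (norm_sub_mul_le_of_mem_closure hx hw).2) (w := star z) (by simp [hz]) h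
  have s1 := pow_le_pow_left₀ (norm_nonneg _) h1 2
  have s2 := pow_le_pow_left₀ (norm_nonneg _) h2 2
  rw [norm_sub_sq (𝕜 := ℂ), norm_sub_sq (𝕜 := ℂ), norm_smul, norm_smul, norm_star] at s1 s2
  simp only [hz, hw, one_mul, inner_smul_right] at s1 s2
  have e1 := congrArg Complex.re hza
  have e2 := congrArg Complex.re hwa
  have f1 : (star z * inner ℂ h (T 0 h)).re = (z * inner ℂ (T 0 h) h).re := by
    rw [← inner_conj_symm, ← Complex.conj_re]; simp
  have f2 : (star w * inner ℂ h (T 1 h)).re = (w * inner ℂ (T 1 h) h).re := by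
    rw [← inner_conj_symm, ← Complex.conj_re]; simp
  have f3 : (star z * inner ℂ (T 1 h) (T 2 h)).re = (z * inner ℂ (T 2 h) (T 1 h)).re := by
    rw [← inner_conj_symm, ← Complex.conj_re]; simp
  have f4 : (star w * inner ℂ (T 0 h) (T 2 h)).re = (w * inner ℂ (T 2 h) (T 0 h)).re := by
    rw [← inner_conj_symm, ← Complex.conj_re]; simp
  simp only [RCLike.re_eq_complex_re, f1, f2, f3, f4] at s1 s2
  rw [mul_sub, Complex.sub_re, Complex.ofReal_re] at e1 e2
  rw [← e1, ← e2]
  linarith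

end Fundamental

/-! ### Joint eigenvalues of commuting pairs in finite dimension -/

section JointEigenvalues

variable {X : Type*} [AddCommGroup X] [Module ℂ X] [FiniteDimensional ℂ X]

/-- If every `S₁ + c S₂` were singular, its `S₂`-invariant kernel would contain a joint eigenvector
with eigenvalues `(-c μ, μ)`. Here `μ ≠ 0`, so `c` can be recovered from the pair, giving infinitely
many pairs from two finite sets of eigenvalues. -/
lemma exists_bijective_add_smul {S₁ S₂ : Module.End ℂ X} (hc : Commute S₁ S₂)
    (h : ∀ x, S₁ x = 0 → S₂ x = 0 → x = 0) : ∃ c : ℂ, Function.Bijective (S₁ + c • S₂) := by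
  by_contra! hcon
  have key : ∀ c : ℂ, ∃ μ : ℂ, μ ≠ 0 ∧ S₂.HasEigenvalue μ ∧ S₁.HasEigenvalue (-(c * μ)) := by
    intro c
    have hker : LinearMap.ker (S₁ + c • S₂) ≠ ⊥ := fun hbot =>
      hcon c ⟨LinearMap.ker_eq_bot.1 hbot,
        LinearMap.injective_iff_surjective.1 (LinearMap.ker_eq_bot.1 hbot)⟩
    have hinv : ∀ x ∈ LinearMap.ker (S₁ + c • S₂), S₂ x ∈ LinearMap.ker (S₁ + c • S₂) := by
      intro x hx
      have hcx : S₁ (S₂ x) = S₂ (S₁ x) := congrArg (fun S => S x) hc.eq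
      rw [LinearMap.mem_ker] at hx ⊢
      have : (S₁ + c • S₂) (S₂ x) = S₂ ((S₁ + c • S₂) x) := by simp [hcx]
      rw [this, hx, map_zero]
    have : Nontrivial (LinearMap.ker (S₁ + c • S₂)) := Submodule.nontrivial_iff_ne_bot.2 hker
    obtain ⟨μ, hμ⟩ := Module.End.exists_eigenvalue (S₂.restrict hinv)
    obtain ⟨v, hv⟩ := hμ.exists_hasEigenvector
    have hv0 : (v : X) ≠ 0 := fun h0 => hv.2 (Subtype.ext h0)
    have e2 : S₂ v = μ • (v : X) := congrArg Subtype.val hv.apply_eq_smul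
    have e1 : S₁ v = (-(c * μ)) • (v : X) := by
      have := LinearMap.mem_ker.1 v.2
      rw [LinearMap.add_apply, LinearMap.smul_apply, e2, smul_smul] at this
      rw [neg_smul]
      exact eq_neg_of_add_eq_zero_left this
    refine ⟨μ, fun h0 => hv0 (h _ ?_ ?_), Module.End.hasEigenvalue_of_hasEigenvector
      (Module.End.hasEigenvector_iff.2 ⟨Module.End.mem_eigenspace_iff.2 e2, hv0⟩),
      Module.End.hasEigenvalue_of_hasEigenvector
      (Module.End.hasEigenvector_iff.2 ⟨Module.End.mem_eigenspace_iff.2 e1, hv0⟩)⟩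
    · rw [e1, h0, mul_zero, neg_zero, zero_smul]
    · rw [e2, h0, zero_smul]
  choose μ hμ0 hμ2 hμ1 using key
  have hinj : Function.Injective fun c => (μ c, -(c * μ c)) := by
    intro c d hcd
    simp only [Prod.mk.injEq, neg_inj] at hcd
    rw [hcd.1] at hcd
    exact mul_right_cancel₀ (hμ0 d) hcd.2
  have hfin : ({a | S₂.HasEigenvalue a} ×ˢ {a | S₁.HasEigenvalue a}).Finite :=
    (Module.End.finite_hasEigenvalue S₂).prod (Module.End.finite_hasEigenvalue S₁)
  exact Set.infinite_of_injective_forall_mem hinj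
    (fun c => Set.mk_mem_prod (hμ2 c) (hμ1 c)) hfin

/-- A trivial common kernel means `v ↦ (S₁ v, S₂ v)` has a left inverse, whose components are `C₁,
C₂` with `C₁ S₁ + C₂ S₂ = 1`. This makes joint eigenvalues a polynomial condition. -/
lemma exists_common_kernel_iff_det (S₁ S₂ : Module.End ℂ X) :
    (∃ v, v ≠ 0 ∧ S₁ v = 0 ∧ S₂ v = 0) ↔
      ∀ C₁ C₂ : Module.End ℂ X, LinearMap.det (C₁ * S₁ + C₂ * S₂) = 0 := by
  constructor
  · rintro ⟨v, hv, h1, h2⟩ C₁ C₂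
    by_contra hdet
    have hu := (LinearMap.isUnit_iff_isUnit_det (C₁ * S₁ + C₂ * S₂)).2 (isUnit_iff_ne_zero.2 hdet)
    refine hv (((Module.End.isUnit_iff _).1 hu).1 ?_)
    simp [h1, h2]
  · intro h
    by_contra! hcon
    have hinj : LinearMap.ker (S₁.prod S₂) = ⊥ := by
      rw [LinearMap.ker_eq_bot']
      intro v hv
      by_contra hv0
      have := Prod.ext_iff.1 hv
      exact hcon v hv0 this.1 this.2
    obtain ⟨g, hg⟩ := LinearMap.exists_leftInverse_of_injective _ hinj
    have h1 := h (g ∘ₗ LinearMap.inl ℂ X X) (g ∘ₗ LinearMap.inr ℂ X X)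
    have h2 : (g ∘ₗ LinearMap.inl ℂ X X) * S₁ + (g ∘ₗ LinearMap.inr ℂ X X) * S₂ = 1 := by
      ext v
      have := congrArg (fun f => f v) hg
      simpa [← map_add] using this
    rw [h2, map_one] at h1
    exact one_ne_zero h1

lemma exists_mvPolynomial_eval_eq_det (G : Fin 4 → Module.End ℂ X) :
    ∃ q : MvPolynomial (Fin 3) ℂ, ∀ x, MvPolynomial.eval x q =
      LinearMap.det (G 0 + x 0 • G 1 + x 1 • G 2 + x 2 • G 3) := by
  classical
  let b := Module.finBasis ℂ X
  let m : Fin 4 → Matrix _ _ (MvPolynomial (Fin 3) ℂ) := fun i =>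
    (LinearMap.toMatrix b b (G i)).map MvPolynomial.C
  let t : Fin 3 → MvPolynomial (Fin 3) ℂ := MvPolynomial.X
  refine ⟨(m 0 + t 0 • m 1 + t 1 • m 2 + t 2 • m 3).det, fun x => ?_⟩
  rw [RingHom.map_det, ← LinearMap.det_toMatrix b]
  congr 1
  ext i j
  simp [m, t]

lemma exists_common_zeros_eq_jointEigenvalues (E₀ E₁ F₀ F₁ : Module.End ℂ X) :
    ∃ S : Set (MvPolynomial (Fin 3) ℂ), ∀ x : Fin 3 → ℂ,
      (∀ p ∈ S, MvPolynomial.eval x p = 0) ↔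
        ∃ v, v ≠ 0 ∧ E₀ v + x 2 • E₁ v = x 0 • v ∧ F₀ v + x 2 • F₁ v = x 1 • v := by
  -- For each `C` this is the determinant of `C₁ (E₀ + x₃ E₁ - x₁) + C₂ (F₀ + x₃ F₁ - x₂)`, sorted
  -- by coordinate.
  choose q hq using fun C : Module.End ℂ X × Module.End ℂ X =>
    exists_mvPolynomial_eval_eq_det ![C.1 * E₀ + C.2 * F₀, -C.1, -C.2, C.1 * E₁ + C.2 * F₁]
  refine ⟨Set.range q, fun x => ?_⟩
  have h := exists_common_kernel_iff_det (E₀ + x 2 • E₁ - x 0 • 1) (F₀ + x 2 • F₁ - x 1 • 1)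
  simp only [LinearMap.sub_apply, LinearMap.add_apply, LinearMap.smul_apply, sub_eq_zero,
    Module.End.one_apply] at h
  rw [h, Set.forall_mem_range, Prod.forall]
  refine forall_congr' fun C₁ => forall_congr' fun C₂ => ?_
  rw [hq]
  simp only [Matrix.cons_val]
  congr! 2
  simp only [mul_sub, mul_add, mul_smul_comm, mul_one, smul_add, smul_neg]
  abel

end JointEigenvalues

section TaylorPair

variable {X : Type*} [NormedAddCommGroup X] [NormedSpace ℂ X] [FiniteDimensional ℂ X]

/-- Some `S₁ + c S₂` is bijective and commutes with both operators; its inverse supplies preimages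
in the Koszul complex. -/
lemma taylorRegularPair_iff {S₁ S₂ : X →L[ℂ] X} (hc : Commute S₁ S₂) :
    TaylorRegularPair S₁ S₂ ↔ ∀ x, S₁ x = 0 → S₂ x = 0 → x = 0 := by
  refine ⟨fun h => h.1, fun h => ?_⟩
  have hcx : ∀ x, S₁ (S₂ x) = S₂ (S₁ x) := fun x => congrArg (fun S => S x) hc.eq
  obtain ⟨c, hinj, hsurj⟩ := exists_bijective_add_smul (S₁ := S₁.toLinearMap)
    (S₂ := S₂.toLinearMap) (LinearMap.ext hcx) h
  refine ⟨h, fun x₁ x₂ h12 => ?_, fun y => ?_⟩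
  · have h12' : S₁ x₂ = S₂ x₁ := by
      rw [neg_add_eq_zero] at h12
      exact h12.symm
    obtain ⟨x, hx⟩ := hsurj (x₁ + c • x₂)
    have hx' : S₁ x + c • S₂ x = x₁ + c • x₂ := hx
    have e1 := congrArg S₁ hx'
    have e2 := congrArg S₂ hx'
    simp only [map_add, map_smul] at e1 e2
    refine ⟨x, hinj ?_, hinj ?_⟩
    · change S₁ x₁ + c • S₂ x₁ = S₁ (S₁ x) + c • S₂ (S₁ x)
      rw [← hcx x, e1, h12']
    · change S₁ x₂ + c • S₂ x₂ = S₁ (S₂ x) + c • S₂ (S₂ x)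
      rw [hcx x, e2, h12']
  · obtain ⟨x, hx⟩ := hsurj y
    refine ⟨-(c • x), x, ?_⟩
    rw [← hx, map_neg, neg_neg, map_smul, add_comm]
    rfl

lemma mem_taylorSpectrumPair_iff {S₁ S₂ : X →L[ℂ] X} (hc : Commute S₁ S₂) (l : ℂ × ℂ) :
    l ∈ taylorSpectrumPair S₁ S₂ ↔ ∃ v, v ≠ 0 ∧ S₁ v = l.1 • v ∧ S₂ v = l.2 • v := by
  have hid : ∀ (a : ℂ) (S : X →L[ℂ] X), Commute (a • ContinuousLinearMap.id ℂ X) S := fun a S =>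
    (Commute.one_left S).smul_left a
  have hc' : Commute (S₁ - l.1 • ContinuousLinearMap.id ℂ X)
      (S₂ - l.2 • ContinuousLinearMap.id ℂ X) :=
    (hc.sub_left (hid _ _)).sub_right ((hid _ _).symm.sub_left (hid _ _))
  rw [taylorSpectrumPair, Set.mem_ofPred_eq, taylorRegularPair_iff hc']
  push Not
  refine exists_congr fun v => ?_
  simp only [sub_apply, smul_apply, ContinuousLinearMap.id_apply,
    sub_eq_zero]
  tauto

end TaylorPair

/-! ### Operator pencils and their distinguished varieties -/

lemma norm_inner_add_norm_inner_lt_one {K : Type*} [NormedAddCommGroup K]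
    [InnerProductSpace ℂ K] {A₁ A₂ : K →L[ℂ] K}
    (hω : ∀ z : ℂ, ‖z‖ = 1 → numericalRadius (A₁ + z • A₂) < 1) {u : K} (hu : ‖u‖ = 1) :
    ‖inner ℂ u (A₁ u)‖ + ‖inner ℂ u (A₂ u)‖ < 1 := by
  obtain ⟨z, hz, hza⟩ := exists_norm_one_mul_eq_norm (inner ℂ (A₁ u) u)
  obtain ⟨w, hw, hwa⟩ := exists_norm_one_mul_eq_norm (inner ℂ (A₂ u) u)
  -- This unimodular coefficient aligns the phases of the two inner products, so their moduli add.
  have hle : ‖inner ℂ ((A₁ + star (star z * w) • A₂) u) u‖ ≤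
      numericalRadius (A₁ + star (star z * w) • A₂) := by
    refine le_csSup ⟨‖A₁ + star (star z * w) • A₂‖, ?_⟩ ⟨u, hu, rfl⟩
    rintro _ ⟨y, hy, rfl⟩
    refine (norm_inner_le_norm _ _).trans ?_
    rw [hy, mul_one]
    exact (ContinuousLinearMap.le_opNorm _ _).trans_eq (by rw [hy, mul_one])
  have hzz : z * star z = 1 := by
    rw [Complex.star_def, Complex.mul_conj, Complex.normSq_eq_norm_sq, hz]
    simp
  have heq : z * inner ℂ ((A₁ + star (star z * w) • A₂) u) u =
      ((‖inner ℂ (A₁ u) u‖ + ‖inner ℂ (A₂ u) u‖ : ℝ) : ℂ) := by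
    rw [add_apply, inner_add_left, smul_apply, inner_smul_left, mul_add, hza,
      Complex.ofReal_add, ← hwa, ← Complex.star_def, star_star]
    linear_combination (w * inner ℂ (A₂ u) u) * hzz
  have hn := congrArg norm heq
  rw [norm_mul, hz, one_mul, Complex.norm_real, Real.norm_of_nonneg (by positivity)] at hn
  rw [← norm_inner_symm (A₁ u), ← norm_inner_symm (A₂ u), ← hn]
  exact hle.trans_lt (hω _ (by simp [hz, hw]))

section Pencil

variable {K : Type*} [NormedAddCommGroup K] [InnerProductSpace ℂ K] [CompleteSpace K]
  {A₁ A₂ : K →L[ℂ] K}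

/-- Compare powers of `z`: the extreme coefficients use that `A₁, A₂` and their adjoints commute,
the linear one is exactly the equality of self-commutators. -/
lemma commute_pencil (hcomm : A₁ * A₂ - A₂ * A₁ = 0)
    (hstar : ContinuousLinearMap.adjoint A₁ * A₁ - A₁ * ContinuousLinearMap.adjoint A₁ =
      ContinuousLinearMap.adjoint A₂ * A₂ - A₂ * ContinuousLinearMap.adjoint A₂) (z : ℂ) :
    Commute (A₁ + z • ContinuousLinearMap.adjoint A₂)
      (A₂ + z • ContinuousLinearMap.adjoint A₁) := by
  simp only [← ContinuousLinearMap.star_eq_adjoint] at hstar ⊢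
  have hc : A₁ * A₂ = A₂ * A₁ := sub_eq_zero.1 hcomm
  have hc' : star A₂ * star A₁ = star A₁ * star A₂ := by rw [← star_mul, hc, star_mul]
  have hs : A₁ * star A₁ + star A₂ * A₂ = A₂ * star A₂ + star A₁ * A₁ := by
    rw [sub_eq_sub_iff_add_eq_add] at hstar
    rw [add_comm (A₂ * _), hstar, add_comm]
  rw [Commute, SemiconjBy, add_mul, add_mul, mul_add, mul_add, mul_add, mul_add,
    mul_smul_comm, mul_smul_comm, smul_mul_assoc, smul_mul_assoc, smul_mul_assoc, smul_mul_assoc,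
    mul_smul_comm, mul_smul_comm, hc, hc', add_assoc, add_assoc, ← add_assoc (z • (_ * _)),
    ← add_assoc (z • (_ * _)), ← smul_add z (_ * _) (_ * _), ← smul_add z (_ * _) (_ * _), hs]

lemma adjoint_commutator_eq_zero (hcomm : A₁ * A₂ - A₂ * A₁ = 0) :
    ContinuousLinearMap.adjoint A₁ * ContinuousLinearMap.adjoint A₂ -
      ContinuousLinearMap.adjoint A₂ * ContinuousLinearMap.adjoint A₁ = 0 := by
  simp only [← ContinuousLinearMap.star_eq_adjoint]
  rw [← star_mul, ← star_mul, ← star_sub, ← neg_sub, hcomm, neg_zero, star_zero]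

lemma mem_omegaStarSet_iff [FiniteDimensional ℂ K]
    (hcomm : A₁ * A₂ - A₂ * A₁ = 0)
    (hstar : ContinuousLinearMap.adjoint A₁ * A₁ - A₁ * ContinuousLinearMap.adjoint A₁ =
      ContinuousLinearMap.adjoint A₂ * A₂ - A₂ * ContinuousLinearMap.adjoint A₂)
    (x : Fin 3 → ℂ) :
    x ∈ omegaStarSet A₁ A₂ ↔ x ∈ closure tetrablock ∧ ∃ v, v ≠ 0 ∧
      A₁ v + x 2 • ContinuousLinearMap.adjoint A₂ v = x 0 • v ∧
      A₂ v + x 2 • ContinuousLinearMap.adjoint A₁ v = x 1 • v := by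
  rw [omegaStarSet, Set.mem_ofPred_eq,
    mem_taylorSpectrumPair_iff (commute_pencil hcomm hstar (x 2))]
  rfl

lemma exists_common_zeros_eq_omegaStarSet [FiniteDimensional ℂ K]
    (hcomm : A₁ * A₂ - A₂ * A₁ = 0)
    (hstar : ContinuousLinearMap.adjoint A₁ * A₁ - A₁ * ContinuousLinearMap.adjoint A₁ =
      ContinuousLinearMap.adjoint A₂ * A₂ - A₂ * ContinuousLinearMap.adjoint A₂) :
    ∃ S : Set (MvPolynomial (Fin 3) ℂ), omegaStarSet A₁ A₂ =
      {x | ∀ p ∈ S, MvPolynomial.eval x p = 0} ∩ closure tetrablock := by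
  obtain ⟨S, hS⟩ := exists_common_zeros_eq_jointEigenvalues A₁.toLinearMap
    (ContinuousLinearMap.adjoint A₂).toLinearMap A₂.toLinearMap
    (ContinuousLinearMap.adjoint A₁).toLinearMap
  refine ⟨S, Set.ext fun x => ?_⟩
  rw [mem_omegaStarSet_iff hcomm hstar, Set.mem_inter_iff, Set.mem_ofPred_eq, hS, and_comm]
  rfl

lemma isClosed_omegaStarSet [FiniteDimensional ℂ K]
    (hcomm : A₁ * A₂ - A₂ * A₁ = 0)
    (hstar : ContinuousLinearMap.adjoint A₁ * A₁ - A₁ * ContinuousLinearMap.adjoint A₁ =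
      ContinuousLinearMap.adjoint A₂ * A₂ - A₂ * ContinuousLinearMap.adjoint A₂) :
    IsClosed (omegaStarSet A₁ A₂) := by
  obtain ⟨S, hS⟩ := exists_common_zeros_eq_omegaStarSet hcomm hstar
  rw [hS]
  refine IsClosed.inter ?_ isClosed_closure
  have : {x : Fin 3 → ℂ | ∀ p ∈ S, MvPolynomial.eval x p = 0} =
      ⋂ p ∈ S, {x | MvPolynomial.eval x p = 0} := by
    ext
    simp
  rw [this]
  exact isClosed_biInter fun p _ => isClosed_eq (MvPolynomial.continuous_eval p) continuous_const

/-- A joint eigenvector `v` of the pencil gives `x = (β₁ + x₃ β̄₂, β₂ + x₃ β̄₁, x₃)` where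
`βᵢ = ⟨Aᵢ v, v⟩ / ‖v‖²`. -/
lemma exists_unit_of_joint_eigenvector {x : Fin 3 → ℂ} {v : K} (hv : v ≠ 0)
    (h0 : A₁ v + x 2 • ContinuousLinearMap.adjoint A₂ v = x 0 • v)
    (h1 : A₂ v + x 2 • ContinuousLinearMap.adjoint A₁ v = x 1 • v) :
    ∃ u : K, ‖u‖ = 1 ∧ x 0 = inner ℂ u (A₁ u) + x 2 * star (inner ℂ u (A₂ u)) ∧
      x 1 = inner ℂ u (A₂ u) + x 2 * star (inner ℂ u (A₁ u)) := by
  set r : ℂ := ((‖v‖⁻¹ : ℝ) : ℂ)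
  have hu : ‖r • v‖ = 1 := by
    rw [norm_smul, Complex.norm_real, norm_inv, norm_norm]
    exact inv_mul_cancel₀ (norm_ne_zero_iff.2 hv)
  have e0 := congrArg (fun y => inner ℂ (r • v) (r • y)) h0
  have e1 := congrArg (fun y => inner ℂ (r • v) (r • y)) h1
  have hin : inner ℂ (r • v) (r • v) = 1 := by
    rw [inner_self_eq_norm_sq_to_K, hu]
    simp
  simp only [smul_add, smul_comm r (x _), ← map_smul, inner_add_right, inner_smul_right _ _ (x _),
    ContinuousLinearMap.adjoint_inner_right, hin, mul_one] at e0 e1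
  refine ⟨r • v, hu, ?_, ?_⟩
  · rw [← e0, ← inner_conj_symm (A₂ _)]
    rfl
  · rw [← e1, ← inner_conj_symm (A₁ _)]
    rfl

lemma isDistinguishedVariety_omegaStarSet [FiniteDimensional ℂ K]
    (hcomm : A₁ * A₂ - A₂ * A₁ = 0)
    (hstar : ContinuousLinearMap.adjoint A₁ * A₁ - A₁ * ContinuousLinearMap.adjoint A₁ =
      ContinuousLinearMap.adjoint A₂ * A₂ - A₂ * ContinuousLinearMap.adjoint A₂)
    (hlt : ∀ u : K, ‖u‖ = 1 → ‖inner ℂ u (A₁ u)‖ + ‖inner ℂ u (A₂ u)‖ < 1) :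
    IsDistinguishedVariety (omegaStarSet A₁ A₂ ∩ tetrablock) := by
  constructor
  · obtain ⟨S, hS⟩ := exists_common_zeros_eq_omegaStarSet hcomm hstar
    exact ⟨S, by rw [hS, Set.inter_assoc, Set.inter_eq_right.2 subset_closure]⟩
  · ext x
    simp only [Set.mem_inter_iff]
    refine and_congr_right fun hx => ?_
    -- Limit points still carry a joint eigenvector, because `omegaStarSet` is closed.
    have hxΩ : x ∈ omegaStarSet A₁ A₂ :=
      (isClosed_omegaStarSet hcomm hstar).closure_subset_iff.2 Set.inter_subset_left hx
    rw [isOpen_tetrablock.frontier_eq, Set.mem_sdiff]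
    obtain ⟨hcl, v, hv, h0, h1⟩ := (mem_omegaStarSet_iff hcomm hstar x).1 hxΩ
    obtain ⟨u, hu, e0, e1⟩ := exists_unit_of_joint_eigenvector hv h0 h1
    constructor
    · rintro ⟨-, hnot⟩
      have h3 : ‖x 2‖ = 1 := by
        refine le_antisymm (norm_le_one_of_mem_closure hcl 2) ?_
        by_contra! h3
        exact hnot (mem_tetrablock_of_norm_add_lt (hlt u hu) h3 e0 e1)
      exact mem_distBoundary_of_norm_third_eq_one e0 e1 h3 (norm_le_one_of_mem_closure hcl 1)
    · intro hb
      exact ⟨hcl, fun hmem => (norm_third_lt_one_of_mem_tetrablock hmem).ne hb.2.1⟩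

end Pencil

/-! ### Matrix polynomials in commuting normal matrices -/

section Normal

variable {K : Type*} [NormedAddCommGroup K] [InnerProductSpace ℂ K]

/-- The self-adjoint operators `B + B*` and `i (B - B*)` commute, so their joint eigenspaces are
orthogonal and span. -/
lemma exists_orthonormalBasis_of_isStarNormal [CompleteSpace K] [FiniteDimensional ℂ K]
    {B : K →L[ℂ] K}
    (hB : Commute (ContinuousLinearMap.adjoint B) B) :
    ∃ (e : OrthonormalBasis (Fin (Module.finrank ℂ K)) ℂ K) (μ : Fin (Module.finrank ℂ K) → ℂ),
      ∀ k, B (e k) = μ k • e k ∧ ContinuousLinearMap.adjoint B (e k) = star (μ k) • e k := by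
  classical
  let X : K →L[ℂ] K := B + ContinuousLinearMap.adjoint B
  let Y : K →L[ℂ] K := Complex.I • B - Complex.I • ContinuousLinearMap.adjoint B
  have hX : X.toLinearMap.IsSymmetric := fun u v => by
    simp [X, inner_add_left, inner_add_right, ContinuousLinearMap.adjoint_inner_left,
      ContinuousLinearMap.adjoint_inner_right, add_comm]
  have hY : Y.toLinearMap.IsSymmetric := fun u v => by
    simp only [Y, ContinuousLinearMap.coe_coe, sub_apply, smul_apply, inner_sub_left,
      inner_sub_right, inner_smul_left, inner_smul_right, ContinuousLinearMap.adjoint_inner_left,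
      ContinuousLinearMap.adjoint_inner_right, Complex.conj_I]
    ring
  have hXY : Commute X Y := by
    refine Commute.sub_right ?_ ?_
    · exact ((Commute.refl B).add_left hB).smul_right _
    · exact (hB.symm.add_left (Commute.refl _)).smul_right _
  have hXY' : Commute X.toLinearMap Y.toLinearMap := by
    refine LinearMap.ext fun v => ?_
    exact congrArg (fun S => S v) hXY.eq
  have hint := LinearMap.IsSymmetric.directSum_isInternal_of_commute hX hY hXY'
  have horth := LinearMap.IsSymmetric.orthogonalFamily_eigenspace_inf_eigenspace hX hY
  -- Only finitely many pairs in `ℂ × ℂ` have a nonzero joint eigenspace; an adapted basis needs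
  -- this finite index type.
  rw [← DirectSum.isInternal_ne_bot_iff] at hint
  have horth' := horth.comp (γ := {i : ℂ × ℂ // Module.End.eigenspace X.toLinearMap i.2 ⊓
    Module.End.eigenspace Y.toLinearMap i.1 ≠ ⊥}) Subtype.val_injective
  let : Fintype {i : ℂ × ℂ // Module.End.eigenspace X.toLinearMap i.2 ⊓
    Module.End.eigenspace Y.toLinearMap i.1 ≠ ⊥} :=
    horth.independent.fintypeNeBotOfFiniteDimensional
  let e := hint.subordinateOrthonormalBasis rfl horth'
  let γ := fun k => (hint.subordinateOrthonormalBasisIndex rfl k horth').1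
  have he : ∀ k, X (e k) = (γ k).2 • e k ∧ Y (e k) = (γ k).1 • e k := fun k => by
    have := hint.subordinateOrthonormalBasis_subordinate rfl k horth'
    exact ⟨Module.End.mem_eigenspace_iff.1 this.1, Module.End.mem_eigenspace_iff.1 this.2⟩
  have hBe : ∀ k, B (e k) = ((2 : ℂ)⁻¹ * ((γ k).2 - Complex.I * (γ k).1)) • e k := by
    intro k
    have h1 : B = (2 : ℂ)⁻¹ • (X - Complex.I • Y) := by
      simp only [X, Y, smul_sub, smul_add, smul_smul, Complex.I_mul_I, neg_smul]
      module
    conv_lhs => rw [h1]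
    rw [smul_apply, sub_apply, smul_apply, (he k).1, (he k).2]
    module
  refine ⟨e, _, fun k => ⟨hBe k, ?_⟩⟩
  refine e.repr.injective (PiLp.ext fun l => ?_)
  rw [e.repr_apply_apply, e.repr_apply_apply, ContinuousLinearMap.adjoint_inner_right, hBe, inner_smul_left, inner_smul_right,
    orthonormal_iff_ite.1 e.orthonormal]
  split_ifs with h
  · rw [h]
    rfl
  · simp

lemma evalOp_apply_of_eigenvector (p : MvPolynomial (Fin 3) ℂ) {B : Fin 3 → K →L[ℂ] K}
    {x : Fin 3 → ℂ} {v : K} (h : ∀ i, B i v = x i • v) :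
    evalOp p B v = MvPolynomial.eval x p • v := by
  have hpow : ∀ i k, (B i ^ k) v = x i ^ k • v := by
    intro i k
    induction k with
    | zero => simp
    | succ k ih => rw [pow_succ, mul_apply_eq_comp, h, map_smul, ih, smul_smul, pow_succ']
  rw [MvPolynomial.eval_eq', evalOp, sum_apply, Finset.sum_smul]
  refine Finset.sum_congr rfl fun s _ => ?_
  rw [smul_apply, mul_apply_eq_comp, mul_apply_eq_comp, hpow, map_smul, hpow, map_smul, map_smul,
    hpow, Fin.prod_univ_three, smul_smul, smul_smul, smul_smul]
  congr 1
  ring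

lemma sum_norm_sq_mulVec_le {m n : ℕ} (A : Matrix (Fin m) (Fin n) ℂ) (c : Fin n → ℂ) :
    ∑ i, ‖∑ j, A i j * c j‖ ^ 2 ≤ ‖A‖ ^ 2 * ∑ j, ‖c j‖ ^ 2 := by
  have h := pow_le_pow_left₀ (norm_nonneg _) (A.l2_opNorm_mulVec (WithLp.toLp 2 c)) 2
  rwa [mul_pow, EuclideanSpace.norm_sq_eq, EuclideanSpace.norm_sq_eq] at h

/-- In the joint eigenbasis the block operator splits into the scalar matrices `P(x k)`, one for
each basis vector. -/
lemma sum_norm_sq_evalOp_le_of_orthonormalBasis {ι : Type*} [Fintype ι] {m n : ℕ}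
    (P : Matrix (Fin m) (Fin n) (MvPolynomial (Fin 3) ℂ)) {B : Fin 3 → K →L[ℂ] K}
    (e : OrthonormalBasis ι ℂ K) {x : ι → Fin 3 → ℂ} (he : ∀ k i, B i (e k) = x k i • e k)
    {M : ℝ} (hM : ∀ k, ‖evalMatrix P (x k)‖ ≤ M) (u : Fin n → K) :
    ∑ i, ‖∑ j, evalOp (P i j) B (u j)‖ ^ 2 ≤ M ^ 2 * ∑ j, ‖u j‖ ^ 2 := by
  have hin : ∀ i j k, inner ℂ (e k) (evalOp (P i j) B (u j)) =
      evalMatrix P (x k) i j * inner ℂ (e k) (u j) := by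
    classical
    intro i j k
    conv_lhs => rw [← e.sum_repr' (u j)]
    rw [map_sum, inner_sum, Finset.sum_eq_single k]
    · rw [map_smul, evalOp_apply_of_eigenvector _ (he k), inner_smul_right, inner_smul_right,
        orthonormal_iff_ite.1 e.orthonormal, if_pos rfl, mul_one, mul_comm]
      rfl
    · intro l _ hl
      rw [map_smul, evalOp_apply_of_eigenvector _ (he l), inner_smul_right, inner_smul_right,
        orthonormal_iff_ite.1 e.orthonormal, if_neg hl.symm, mul_zero, mul_zero]
    · simp
  calc ∑ i, ‖∑ j, evalOp (P i j) B (u j)‖ ^ 2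
      = ∑ k, ∑ i, ‖∑ j, evalMatrix P (x k) i j * inner ℂ (e k) (u j)‖ ^ 2 := by
        rw [Finset.sum_comm]
        refine Finset.sum_congr rfl fun i _ => ?_
        rw [← e.sum_sq_norm_inner_right]
        simp only [inner_sum, hin]
    _ ≤ ∑ k, M ^ 2 * ∑ j, ‖inner ℂ (e k) (u j)‖ ^ 2 := by
        refine Finset.sum_le_sum fun k _ => (sum_norm_sq_mulVec_le _ _).trans ?_
        gcongr
        exact hM k
    _ = M ^ 2 * ∑ j, ‖u j‖ ^ 2 := by
        rw [← Finset.mul_sum, Finset.sum_comm]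
        simp only [e.sum_sq_norm_inner_right]

end Normal

/-! ### The pencil over the unit circle -/

section UnitCircle

variable {K : Type*} [NormedAddCommGroup K] [InnerProductSpace ℂ K] [CompleteSpace K]
  [FiniteDimensional ℂ K] {A₁ A₂ : K →L[ℂ] K}

/-- The pencil `(A₁ + z A₂*, A₂ + z A₁*, z)`. -/
noncomputable def pencil (A₁ A₂ : K →L[ℂ] K) (z : ℂ) : Fin 3 → K →L[ℂ] K :=
  ![A₁ + z • ContinuousLinearMap.adjoint A₂, A₂ + z • ContinuousLinearMap.adjoint A₁, z • 1]

lemma exists_orthonormalBasis_pencil (hcomm : A₁ * A₂ - A₂ * A₁ = 0)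
    (hstar : ContinuousLinearMap.adjoint A₁ * A₁ - A₁ * ContinuousLinearMap.adjoint A₁ =
      ContinuousLinearMap.adjoint A₂ * A₂ - A₂ * ContinuousLinearMap.adjoint A₂)
    (hle : ∀ u : K, ‖u‖ = 1 → ‖inner ℂ u (A₁ u)‖ + ‖inner ℂ u (A₂ u)‖ ≤ 1)
    {z : ℂ} (hz : ‖z‖ = 1) :
    ∃ (e : OrthonormalBasis (Fin (Module.finrank ℂ K)) ℂ K)
      (x : Fin (Module.finrank ℂ K) → Fin 3 → ℂ), ∀ k,
        (∀ i, pencil A₁ A₂ z i (e k) = x k i • e k) ∧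
          x k ∈ omegaStarSet A₁ A₂ ∩ distBoundary := by
  have hzz : z * star z = 1 := by
    rw [Complex.star_def, Complex.mul_conj, Complex.normSq_eq_norm_sq, hz]
    simp
  -- One pencil is a unimodular multiple of the adjoint of the other, so commuting of the two
  -- becomes normality and one eigenbasis serves both.
  have hB1 : A₁ + z • ContinuousLinearMap.adjoint A₂ =
      z • ContinuousLinearMap.adjoint (A₂ + z • ContinuousLinearMap.adjoint A₁) := by
    simp only [← ContinuousLinearMap.star_eq_adjoint, star_add, star_smul, star_star, smul_add,
      smul_smul, hzz, one_smul, add_comm]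
  have hnormal : Commute (ContinuousLinearMap.adjoint (A₂ + z • ContinuousLinearMap.adjoint A₁))
      (A₂ + z • ContinuousLinearMap.adjoint A₁) := by
    have h := (commute_pencil hcomm hstar z).smul_left (star z)
    rwa [hB1, smul_smul, mul_comm, hzz, one_smul] at h
  obtain ⟨e, μ, he⟩ := exists_orthonormalBasis_of_isStarNormal hnormal
  have h0 : ∀ k, (A₁ + z • ContinuousLinearMap.adjoint A₂) (e k) = (z * star (μ k)) • e k := by
    intro k
    rw [hB1, smul_apply, (he k).2, smul_smul]
  refine ⟨e, fun k => ![z * star (μ k), μ k, z], fun k => ⟨fun i => ?_, ?_⟩⟩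
  · fin_cases i
    · exact h0 k
    · exact (he k).1
    · rfl
  · have hek : e k ≠ 0 := e.orthonormal.ne_zero k
    have e0 : A₁ (e k) + (![z * star (μ k), μ k, z] : Fin 3 → ℂ) 2 •
        ContinuousLinearMap.adjoint A₂ (e k) =
        (![z * star (μ k), μ k, z] : Fin 3 → ℂ) 0 • e k := h0 k
    have e1 : A₂ (e k) + (![z * star (μ k), μ k, z] : Fin 3 → ℂ) 2 •
        ContinuousLinearMap.adjoint A₁ (e k) =
        (![z * star (μ k), μ k, z] : Fin 3 → ℂ) 1 • e k := (he k).1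
    obtain ⟨u, hu, f0, f1⟩ := exists_unit_of_joint_eigenvector hek e0 e1
    have hb : ![z * star (μ k), μ k, z] ∈ distBoundary := by
      refine mem_distBoundary_of_norm_third_eq_one f0 f1 hz ?_
      rw [f1]
      refine (norm_add_le _ _).trans ?_
      rw [norm_mul, norm_star]
      simp only [Matrix.cons_val, hz, one_mul]
      linarith [hle u hu]
    exact ⟨(mem_omegaStarSet_iff hcomm hstar _).2
      ⟨distBoundary_subset_closure hb, e k, hek, e0, e1⟩, hb⟩

lemma isCompact_omegaStarSet_inter_distBoundary (hcomm : A₁ * A₂ - A₂ * A₁ = 0)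
    (hstar : ContinuousLinearMap.adjoint A₁ * A₁ - A₁ * ContinuousLinearMap.adjoint A₁ =
      ContinuousLinearMap.adjoint A₂ * A₂ - A₂ * ContinuousLinearMap.adjoint A₂) :
    IsCompact (omegaStarSet A₁ A₂ ∩ distBoundary) := by
  refine Metric.isCompact_of_isClosed_isBounded
    ((isClosed_omegaStarSet hcomm hstar).inter isClosed_distBoundary)
    ((Metric.isBounded_closedBall (x := (0 : Fin 3 → ℂ)) (r := 1)).subset fun x hx => ?_)
  rw [mem_closedBall_zero_iff, pi_norm_le_iff_of_nonneg zero_le_one]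
  exact norm_le_one_of_mem_closure hx.1.1

end UnitCircle

/-! ### Operator polynomials acting on sequences -/

section SequenceAction

variable {K : Type*} [NormedAddCommGroup K] [InnerProductSpace ℂ K] {I : Type*}

/-- Coordinatewise action of operators on families of vectors. -/
noncomputable def diagonalAction (K I : Type*) [NormedAddCommGroup K] [InnerProductSpace ℂ K] :
    (K →L[ℂ] K) →+* Module.End ℂ (I → K) where
  toFun a := a.toLinearMap.compLeft I
  map_one' := rfl
  map_mul' _ _ := rfl
  map_zero' := rfl
  map_add' _ _ := rfl

/-- The action of an operator polynomial on families `d : I → K`, where the variable acts as the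
translation `d ↦ d ∘ s`. -/
noncomputable def sequenceAction (s : I → I) : Polynomial (K →L[ℂ] K) →+* Module.End ℂ (I → K) :=
  Polynomial.eval₂RingHom' (diagonalAction K I) (LinearMap.funLeft ℂ K s) fun _ => rfl

lemma sequenceAction_eq_eval₂ (s : I → I) (F : Polynomial (K →L[ℂ] K)) :
    sequenceAction s F = F.eval₂ (diagonalAction K I) (LinearMap.funLeft ℂ K s) :=
  rfl

lemma sequenceAction_C (s : I → I) (a : K →L[ℂ] K) (d : I → K) (i : I) :
    sequenceAction s (Polynomial.C a) d i = a (d i) := by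
  rw [sequenceAction_eq_eval₂, Polynomial.eval₂_C]
  rfl

lemma sequenceAction_X (s : I → I) (d : I → K) (i : I) :
    sequenceAction s (Polynomial.X : Polynomial (K →L[ℂ] K)) d i = d (s i) := by
  rw [sequenceAction_eq_eval₂, Polynomial.eval₂_X]
  rfl

lemma sequenceAction_apply (s : I → I) (F : Polynomial (K →L[ℂ] K)) (d : I → K) (i : I) :
    sequenceAction s F d i = ∑ k ∈ Finset.range (F.natDegree + 1), F.coeff k (d (s^[k] i)) := by
  have hpow : ∀ (k : ℕ) (d : I → K) (i : I), (LinearMap.funLeft ℂ K s ^ k) d i = d (s^[k] i) := by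
    intro k
    induction k with
    | zero => exact fun _ _ => rfl
    | succ k ih =>
      intro d i
      rw [pow_succ', Module.End.mul_apply, LinearMap.funLeft_apply, ih, Function.iterate_succ_apply]
  rw [sequenceAction_eq_eval₂, Polynomial.eval₂_eq_sum_range, LinearMap.sum_apply, Finset.sum_apply]
  refine Finset.sum_congr rfl fun k _ => ?_
  rw [Module.End.mul_apply, ← hpow k d i]
  rfl

/-- Evaluation of an operator polynomial at a scalar. -/
noncomputable def scalarEval (z : ℂ) : Polynomial (K →L[ℂ] K) →+* (K →L[ℂ] K) :=
  Polynomial.eval₂RingHom' (RingHom.id _) (z • 1) fun a =>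
    (Commute.one_right a).smul_right z

lemma scalarEval_eq_eval₂ (z : ℂ) (F : Polynomial (K →L[ℂ] K)) :
    scalarEval z F = F.eval₂ (RingHom.id _) (z • 1) :=
  rfl

lemma scalarEval_C (z : ℂ) (a : K →L[ℂ] K) : scalarEval z (Polynomial.C a) = a :=
  Polynomial.eval₂_C _ _

lemma scalarEval_X (z : ℂ) : scalarEval z (Polynomial.X : Polynomial (K →L[ℂ] K)) = z • 1 :=
  Polynomial.eval₂_X _ _

lemma scalarEval_apply (z : ℂ) (F : Polynomial (K →L[ℂ] K)) (v : K) :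
    scalarEval z F v = ∑ k ∈ Finset.range (F.natDegree + 1), z ^ k • F.coeff k v := by
  rw [scalarEval_eq_eval₂, Polynomial.eval₂_eq_sum_range, sum_apply]
  refine Finset.sum_congr rfl fun k _ => ?_
  rw [smul_pow, one_pow, mul_smul_one, smul_apply]
  rfl

/-! ### Discrete Fourier transform on a cyclic group -/

section Fourier

variable {N : ℕ} [NeZero N]

lemma norm_stdAddChar (a : ZMod N) : ‖ZMod.stdAddChar a‖ = 1 :=
  Circle.norm_coe _

lemma sum_norm_sq_dft (d : ZMod N → K) :
    ∑ a, ‖ZMod.dft d a‖ ^ 2 = N * ∑ q, ‖d q‖ ^ 2 := by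
  have hN : (N : ℂ) ≠ 0 := Nat.cast_ne_zero.2 (NeZero.ne N)
  have hinv : ∀ q, ∑ a, ZMod.stdAddChar (a * q) • ZMod.dft d a = (N : ℂ) • d q := by
    intro q
    have h := ZMod.invDFT_apply (ZMod.dft d) q
    rw [LinearEquiv.symm_apply_apply] at h
    rw [h, smul_smul, mul_inv_cancel₀ hN, one_smul]
  have hconj : ∀ a : ZMod N, (starRingEnd ℂ) (ZMod.stdAddChar (-a)) = ZMod.stdAddChar a := by
    intro a
    rw [← Complex.inv_eq_conj (norm_stdAddChar _), ← AddChar.map_neg_eq_inv, neg_neg]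
  have h : ∑ a, inner ℂ (ZMod.dft d a) (ZMod.dft d a) = (N : ℂ) * ∑ q, inner ℂ (d q) (d q) := by
    calc ∑ a, inner ℂ (ZMod.dft d a) (ZMod.dft d a)
        = ∑ a, ∑ q, inner ℂ (d q) (ZMod.stdAddChar (a * q) • ZMod.dft d a) := by
          refine Finset.sum_congr rfl fun a _ => ?_
          conv_lhs => rw [ZMod.dft_apply, sum_inner]
          refine Finset.sum_congr rfl fun q _ => ?_
          rw [inner_smul_left, hconj, inner_smul_right, mul_comm q a, ZMod.dft_apply]
      _ = _ := by
          rw [Finset.sum_comm, Finset.mul_sum]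
          refine Finset.sum_congr rfl fun q _ => ?_
          rw [← inner_sum, hinv, inner_smul_right]
  simp only [inner_self_eq_norm_sq_to_K] at h
  apply Complex.ofReal_injective
  push_cast
  exact h

/-- The transform turns cyclic translation into multiplication by a root of unity, and it commutes
with operators acting coordinatewise. -/
lemma dft_sequenceAction (F : Polynomial (K →L[ℂ] K)) (d : ZMod N → K) (a : ZMod N) :
    ZMod.dft (sequenceAction (· + 1) F d) a =
      scalarEval (ZMod.stdAddChar a) F (ZMod.dft d a) := by
  have hit : ∀ (k : ℕ) (q : ZMod N), (· + 1)^[k] q = q + k := by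
    intro k
    induction k with
    | zero => simp
    | succ k ih =>
      intro q
      rw [Function.iterate_succ_apply, ih]
      push_cast
      ring
  rw [ZMod.dft_apply, scalarEval_apply]
  simp only [sequenceAction_apply, Finset.smul_sum, hit]
  rw [Finset.sum_comm]
  refine Finset.sum_congr rfl fun k _ => ?_
  rw [ZMod.dft_apply, map_sum, Finset.smul_sum]
  refine Fintype.sum_equiv (Equiv.addRight (k : ZMod N)) _ _ fun q => ?_
  rw [Equiv.coe_addRight, map_smul, smul_smul, ← AddChar.map_nsmul_eq_pow, ← AddChar.map_add_eq_mul]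
  congr 2
  rw [nsmul_eq_mul]
  ring

lemma sum_norm_sq_cyclic_le {m n : ℕ} {F : Fin m → Fin n → Polynomial (K →L[ℂ] K)} {M : ℝ}
    (hF : ∀ z : ℂ, ‖z‖ = 1 → ∀ u : Fin n → K,
      ∑ i, ‖∑ j, scalarEval z (F i j) (u j)‖ ^ 2 ≤ M ^ 2 * ∑ j, ‖u j‖ ^ 2)
    (d : Fin n → ZMod N → K) :
    ∑ q, ∑ i, ‖∑ j, sequenceAction (· + 1) (F i j) (d j) q‖ ^ 2 ≤
      M ^ 2 * ∑ q, ∑ j, ‖d j q‖ ^ 2 := by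
  have hN : (0 : ℝ) < N := Nat.cast_pos.2 (NeZero.pos N)
  refine le_of_mul_le_mul_left ?_ hN
  have h1 : ∀ i, (N : ℝ) * ∑ q, ‖∑ j, sequenceAction (· + 1) (F i j) (d j) q‖ ^ 2 =
      ∑ a, ‖∑ j, scalarEval (ZMod.stdAddChar a) (F i j) (ZMod.dft (d j) a)‖ ^ 2 := by
    intro i
    have := sum_norm_sq_dft (N := N) (∑ j, sequenceAction (· + 1) (F i j) (d j))
    simp only [Finset.sum_apply] at this
    rw [← this, map_sum]
    simp only [Finset.sum_apply, dft_sequenceAction]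
  calc (N : ℝ) * ∑ q, ∑ i, ‖∑ j, sequenceAction (· + 1) (F i j) (d j) q‖ ^ 2
      = ∑ a, ∑ i, ‖∑ j, scalarEval (ZMod.stdAddChar a) (F i j) (ZMod.dft (d j) a)‖ ^ 2 := by
        rw [Finset.sum_comm, Finset.mul_sum, Finset.sum_comm (s := Finset.univ (α := ZMod N))]
        exact Finset.sum_congr rfl fun i _ => h1 i
    _ ≤ ∑ a, M ^ 2 * ∑ j, ‖ZMod.dft (d j) a‖ ^ 2 :=
        Finset.sum_le_sum fun a _ => hF _ (norm_stdAddChar a) _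
    _ = N * (M ^ 2 * ∑ q, ∑ j, ‖d j q‖ ^ 2) := by
        rw [← Finset.mul_sum, Finset.sum_comm, Finset.sum_comm (s := Finset.univ (α := ZMod N))]
        simp only [sum_norm_sq_dft, ← Finset.mul_sum]
        ring

end Fourier

/-- Matrix polynomials in the backward shift satisfy the von Neumann inequality, in a form with
finite sums. -/
lemma sum_norm_sq_shift_le {m n : ℕ} {F : Fin m → Fin n → Polynomial (K →L[ℂ] K)} {M : ℝ}
    (hF : ∀ z : ℂ, ‖z‖ = 1 → ∀ u : Fin n → K,
      ∑ i, ‖∑ j, scalarEval z (F i j) (u j)‖ ^ 2 ≤ M ^ 2 * ∑ j, ‖u j‖ ^ 2)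
    (d : Fin n → ℕ → K) {R : ℕ} (hR : ∀ i j, (F i j).natDegree < R) (L : ℕ) :
    ∑ l ∈ Finset.range L, ∑ i, ‖∑ j, sequenceAction Nat.succ (F i j) (d j) l‖ ^ 2 ≤
      M ^ 2 * ∑ l ∈ Finset.range (L + R), ∑ j, ‖d j l‖ ^ 2 := by
  rcases Nat.eq_zero_or_pos (L + R) with h0 | hpos
  · obtain ⟨rfl, rfl⟩ : L = 0 ∧ R = 0 := by omega
    simp
  have : NeZero (L + R) := ⟨hpos.ne'⟩
  -- Wrap the first `L + R` terms around a cycle. From an index below `L`, fewer than `R` steps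
  -- never cross the seam, so both actions agree there.
  let d' : Fin n → ZMod (L + R) → K := fun j q => d j q.val
  have hsum : ∀ g : ℕ → ℝ, ∑ q : ZMod (L + R), g q.val = ∑ l ∈ Finset.range (L + R), g l := by
    intro g
    refine Finset.sum_bij (fun q _ => q.val) (fun q _ => Finset.mem_range.2 q.val_lt)
      (fun a _ b _ h => ZMod.val_injective _ h)
      (fun l hl => ⟨(l : ZMod (L + R)), Finset.mem_univ _,
        ZMod.val_natCast_of_lt (Finset.mem_range.1 hl)⟩) (fun _ _ => rfl)
  have hcyc := sum_norm_sq_cyclic_le hF d'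
  rw [hsum fun l => ∑ j, ‖d j l‖ ^ 2] at hcyc
  refine le_trans ?_ hcyc
  have hit : ∀ (k l : ℕ), Nat.succ^[k] l = l + k := fun k l => Nat.succ_iterate l k
  have hit' : ∀ (k l : ℕ), (· + 1)^[k] (l : ZMod (L + R)) = ((l + k : ℕ) : ZMod (L + R)) := by
    intro k
    induction k with
    | zero => simp
    | succ k ih =>
      intro l
      rw [Function.iterate_succ_apply, ← Nat.cast_succ, ih]
      congr 1
      omega
  have heq : ∀ l ∈ Finset.range L, ∀ i,
      ‖∑ j, sequenceAction Nat.succ (F i j) (d j) l‖ ^ 2 =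
      ‖∑ j, sequenceAction (· + 1) (F i j) (d' j) (l : ZMod (L + R))‖ ^ 2 := by
    intro l hl i
    congr 2
    refine Finset.sum_congr rfl fun j _ => ?_
    rw [sequenceAction_apply, sequenceAction_apply]
    refine Finset.sum_congr rfl fun k hk => ?_
    rw [hit, hit']
    simp only [d']
    rw [ZMod.val_natCast_of_lt]
    have := hR i j
    rw [Finset.mem_range] at hl hk
    omega
  calc ∑ l ∈ Finset.range L, ∑ i, ‖∑ j, sequenceAction Nat.succ (F i j) (d j) l‖ ^ 2
      = ∑ l ∈ Finset.range L, ∑ i,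
          ‖∑ j, sequenceAction (· + 1) (F i j) (d' j) (l : ZMod (L + R))‖ ^ 2 :=
        Finset.sum_congr rfl fun l hl => Finset.sum_congr rfl fun i _ => heq l hl i
    _ ≤ ∑ l ∈ Finset.range (L + R), ∑ i,
          ‖∑ j, sequenceAction (· + 1) (F i j) (d' j) (l : ZMod (L + R))‖ ^ 2 :=
        Finset.sum_le_sum_of_subset_of_nonneg (Finset.range_mono (Nat.le_add_right L R))
          fun _ _ _ => by positivity
    _ = _ := by
        rw [← hsum]
        simp only [ZMod.natCast_zmod_val]

end SequenceAction

/-! ### The functional model -/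

section Model

variable {H K : Type*} [NormedAddCommGroup H] [InnerProductSpace ℂ H]
  [NormedAddCommGroup K] [InnerProductSpace ℂ K]

/-- The operator polynomial `∑ cₛ t₁^{s₁} t₂^{s₂} t₃^{s₃}` for a triple `t` of operator
polynomials. -/
noncomputable def evalPoly (p : MvPolynomial (Fin 3) ℂ) (t : Fin 3 → Polynomial (K →L[ℂ] K)) :
    Polynomial (K →L[ℂ] K) :=
  ∑ s ∈ p.support, Polynomial.C (p.coeff s • 1) * (t 0 ^ s 0 * t 1 ^ s 1 * t 2 ^ s 2)

lemma scalarEval_evalPoly (p : MvPolynomial (Fin 3) ℂ) (t : Fin 3 → Polynomial (K →L[ℂ] K))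
    (z : ℂ) : scalarEval z (evalPoly p t) = evalOp p fun i => scalarEval z (t i) := by
  rw [evalPoly, evalOp, map_sum]
  refine Finset.sum_congr rfl fun s _ => ?_
  simp only [map_mul, map_pow, scalarEval_C, smul_one_mul]

/-- Both sides list the factors of each monomial in the same order, so the intertwining carries over
without commutativity. -/
lemma sequenceAction_evalPoly {I : Type*} (s : I → I) (p : MvPolynomial (Fin 3) ℂ)
    {T : Fin 3 → H →L[ℂ] H} {t : Fin 3 → Polynomial (K →L[ℂ] K)} {W : H →ₗ[ℂ] I → K}
    (hW : ∀ i h, W (T i h) = sequenceAction s (t i) (W h)) (h : H) :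
    W (evalOp p T h) = sequenceAction s (evalPoly p t) (W h) := by
  have hpow : ∀ i k h, W ((T i ^ k) h) = (sequenceAction s (t i) ^ k) (W h) := by
    intro i k
    induction k with
    | zero => simp
    | succ k ih =>
      intro h
      rw [pow_succ, mul_apply_eq_comp, ih, hW, pow_succ, Module.End.mul_apply]
  rw [evalPoly, evalOp, map_sum, sum_apply, map_sum, LinearMap.sum_apply]
  refine Finset.sum_congr rfl fun r _ => ?_
  have hC : ∀ (a : ℂ) (d : I → K), sequenceAction s (Polynomial.C (a • 1)) d = a • d := by
    intro a d
    funext i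
    rw [sequenceAction_C]
    rfl
  rw [smul_apply, map_smul, mul_apply_eq_comp, mul_apply_eq_comp, hpow, hpow, hpow, map_mul,
    Module.End.mul_apply, hC, map_mul, map_mul, map_pow, map_pow, map_pow, Module.End.mul_apply,
    Module.End.mul_apply]

variable [CompleteSpace K]

/-- The operator polynomials `(A₁ + X A₂*, A₂ + X A₁*, X)`. -/
noncomputable def pencilPoly (A₁ A₂ : K →L[ℂ] K) : Fin 3 → Polynomial (K →L[ℂ] K) :=
  ![Polynomial.C A₁ + Polynomial.C (ContinuousLinearMap.adjoint A₂) * Polynomial.X,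
    Polynomial.C A₂ + Polynomial.C (ContinuousLinearMap.adjoint A₁) * Polynomial.X, Polynomial.X]

lemma scalarEval_pencilPoly (A₁ A₂ : K →L[ℂ] K) (z : ℂ) :
    (fun i => scalarEval z (pencilPoly A₁ A₂ i)) = pencil A₁ A₂ z := by
  funext i
  fin_cases i
  · change scalarEval z (Polynomial.C A₁ + _ * _) = A₁ + _
    rw [map_add, map_mul, scalarEval_C, scalarEval_C, scalarEval_X, mul_smul_one]
  · change scalarEval z (Polynomial.C A₂ + _ * _) = A₂ + _
    rw [map_add, map_mul, scalarEval_C, scalarEval_C, scalarEval_X, mul_smul_one]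
  · exact scalarEval_X z

/-- If `D` intertwines `T` with the pencil of `A₁, A₂` along a contraction `T₃` with `T₃ⁿ → 0`, and
`‖D h‖² = ‖h‖² - ‖T₃ h‖²`, then bounds for matrix polynomials in the pencil on the unit circle
carry over to `T`. -/
lemma sum_norm_sq_evalOp_le_of_pencil {T : Fin 3 → H →L[ℂ] H} {A₁ A₂ : K →L[ℂ] K} {D : H →L[ℂ] K}
    (hT : ∀ i j, Commute (T i) (T j))
    (hD : ∀ h, ‖D h‖ ^ 2 = ‖h‖ ^ 2 - ‖T 2 h‖ ^ 2)
    (h0 : ∀ h, D (T 0 h) = A₁ (D h) + ContinuousLinearMap.adjoint A₂ (D (T 2 h)))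
    (h1 : ∀ h, D (T 1 h) = A₂ (D h) + ContinuousLinearMap.adjoint A₁ (D (T 2 h)))
    (hpure : ∀ h, Filter.Tendsto (fun n : ℕ => (T 2 ^ n) h) Filter.atTop (nhds 0))
    {m n : ℕ} (P : Matrix (Fin m) (Fin n) (MvPolynomial (Fin 3) ℂ)) {M : ℝ}
    (hP : ∀ z : ℂ, ‖z‖ = 1 → ∀ u : Fin n → K,
      ∑ i, ‖∑ j, evalOp (P i j) (pencil A₁ A₂ z) (u j)‖ ^ 2 ≤ M ^ 2 * ∑ j, ‖u j‖ ^ 2)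
    (h : Fin n → H) :
    ∑ i, ‖∑ j, evalOp (P i j) T (h j)‖ ^ 2 ≤ M ^ 2 * ∑ j, ‖h j‖ ^ 2 := by
  -- The model map `h ↦ (D T₃ᵏ h)ₖ`; by telescoping, its partial square sums are `‖h‖² - ‖T₃ᴸ h‖²`.
  let W : H →ₗ[ℂ] ℕ → K := LinearMap.pi fun k => (D ∘L (T 2 ^ k)).toLinearMap
  have hWapp : ∀ h k, W h k = D ((T 2 ^ k) h) := fun _ _ => rfl
  have hpc : ∀ i k h, (T 2 ^ k) (T i h) = T i ((T 2 ^ k) h) := fun i k h =>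
    congrArg (fun S => S h) ((hT 2 i).pow_left k).eq
  have hsucc : ∀ k h, T 2 ((T 2 ^ k) h) = (T 2 ^ (k + 1)) h := fun k h => by
    rw [pow_succ', mul_apply_eq_comp]
  have hW : ∀ i h, W (T i h) = sequenceAction Nat.succ (pencilPoly A₁ A₂ i) (W h) := by
    intro i h
    funext k
    fin_cases i
    · change W (T 0 h) k = sequenceAction Nat.succ (Polynomial.C A₁ + _ * _) (W h) k
      rw [map_add, map_mul, LinearMap.add_apply, Module.End.mul_apply, Pi.add_apply,
        sequenceAction_C, sequenceAction_C, sequenceAction_X, hWapp, hWapp, hWapp, hpc, h0, hsucc]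
    · change W (T 1 h) k = sequenceAction Nat.succ (Polynomial.C A₂ + _ * _) (W h) k
      rw [map_add, map_mul, LinearMap.add_apply, Module.End.mul_apply, Pi.add_apply,
        sequenceAction_C, sequenceAction_C, sequenceAction_X, hWapp, hWapp, hWapp, hpc, h1, hsucc]
    · change W (T 2 h) k = sequenceAction Nat.succ Polynomial.X (W h) k
      rw [sequenceAction_X, hWapp, hWapp, hpc, hsucc]
  have htel : ∀ (L : ℕ) (y : H), ∑ l ∈ Finset.range L, ‖W y l‖ ^ 2 =
      ‖y‖ ^ 2 - ‖(T 2 ^ L) y‖ ^ 2 := by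
    intro L y
    simp only [hWapp, hD, hsucc]
    rw [Finset.sum_range_sub' (fun l => ‖(T 2 ^ l) y‖ ^ 2)]
    simp
  let F : Fin m → Fin n → Polynomial (K →L[ℂ] K) := fun i j => evalPoly (P i j) (pencilPoly A₁ A₂)
  have hF : ∀ z : ℂ, ‖z‖ = 1 → ∀ u : Fin n → K,
      ∑ i, ‖∑ j, scalarEval z (F i j) (u j)‖ ^ 2 ≤ M ^ 2 * ∑ j, ‖u j‖ ^ 2 := by
    intro z hz u
    simp only [F, scalarEval_evalPoly, scalarEval_pencilPoly]
    exact hP z hz u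
  let R := (∑ i, ∑ j, (F i j).natDegree) + 1
  have hR : ∀ i j, (F i j).natDegree < R := fun i j => Nat.lt_succ_of_le <|
    (Finset.single_le_sum (f := fun j => (F i j).natDegree) (fun _ _ => Nat.zero_le _)
      (Finset.mem_univ j)).trans
    (Finset.single_le_sum (f := fun i => ∑ j, (F i j).natDegree) (fun _ _ => Nat.zero_le _)
      (Finset.mem_univ i))
  let y : Fin m → H := fun i => ∑ j, evalOp (P i j) T (h j)
  have hWy : ∀ i l, W (y i) l = ∑ j, sequenceAction Nat.succ (F i j) (W (h j)) l := by
    intro i l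
    simp only [y, map_sum, Finset.sum_apply, sequenceAction_evalPoly Nat.succ _ hW, F]
  have hle : ∀ L : ℕ, ∑ i, (‖y i‖ ^ 2 - ‖(T 2 ^ L) (y i)‖ ^ 2) ≤ M ^ 2 * ∑ j, ‖h j‖ ^ 2 := by
    intro L
    have h2 := sum_norm_sq_shift_le hF (fun j => W (h j)) hR L
    simp only [← hWy] at h2
    rw [Finset.sum_comm, Finset.sum_comm (s := Finset.range (L + R))] at h2
    simp only [htel] at h2
    refine h2.trans ?_
    gcongr
    exact sub_le_self _ (sq_nonneg _)
  -- Purity enters only here: the part of `‖y i‖²` missed by the first `L` terms tends to zero.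
  have hlim : Filter.Tendsto (fun L : ℕ => ∑ i, (‖y i‖ ^ 2 - ‖(T 2 ^ L) (y i)‖ ^ 2)) Filter.atTop
      (nhds (∑ i, (‖y i‖ ^ 2 - ‖(0 : H)‖ ^ 2))) :=
    tendsto_finsetSum _ fun i _ => tendsto_const_nhds.sub ((hpure (y i)).norm.pow 2)
  have := le_of_tendsto' hlim hle
  simpa using this

end Model

/-! ### Assembling the von Neumann inequality -/

section Main

variable {H : Type*} [NormedAddCommGroup H] [InnerProductSpace ℂ H]

lemma norm_blockOp_le {m n : ℕ} {B : Matrix (Fin m) (Fin n) (H →L[ℂ] H)} {M : ℝ} (hM : 0 ≤ M)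
    (h : ∀ u : Fin n → H, ∑ i, ‖∑ j, B i j (u j)‖ ^ 2 ≤ M ^ 2 * ∑ j, ‖u j‖ ^ 2) :
    ‖blockOp B‖ ≤ M := by
  refine ContinuousLinearMap.opNorm_le_bound _ hM fun u => ?_
  refine le_of_sq_le_sq ?_ (by positivity)
  rw [mul_pow, PiLp.norm_sq_eq_of_L2, PiLp.norm_sq_eq_of_L2]
  have hi : ∀ i, blockOp B u i = ∑ j, B i j (u j) := fun i => by
    simp [blockOp]
  simp only [hi]
  exact h _

variable [CompleteSpace H]

/-- A zero defect space would make `S` isometric, against `Sⁿ → 0`. Nontriviality provides a joint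
eigenvalue, hence a nonempty set for the maximum. -/
lemma nontrivial_defectSpace [Nontrivial H] {S : H →L[ℂ] H} (hS : ‖S‖ ≤ 1)
    (hpure : ∀ h, Filter.Tendsto (fun n : ℕ => (S ^ n) h) Filter.atTop (nhds 0)) :
    Nontrivial (defectSpace S) := by
  by_contra hcon
  rw [not_nontrivial_iff_subsingleton] at hcon
  obtain ⟨v, hv⟩ := exists_ne (0 : H)
  have hiso : ∀ h, ‖S h‖ ^ 2 = ‖h‖ ^ 2 := fun h => by
    have := norm_defectMap_sq hS h
    rw [Subsingleton.elim (defectMap S h) 0, norm_zero] at this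
    linarith
  have hn : ∀ n : ℕ, ‖(S ^ n) v‖ ^ 2 = ‖v‖ ^ 2 := by
    intro n
    induction n with
    | zero => simp
    | succ n ih => rw [pow_succ' S, mul_apply_eq_comp, hiso, ih]
  have hlim := (hpure v).norm.pow 2
  simp only [hn, norm_zero] at hlim
  have := tendsto_nhds_unique hlim tendsto_const_nhds
  refine hv (norm_eq_zero.1 ?_)
  simpa using this.symm

variable {T : Fin 3 → H →L[ℂ] H} {A₁ A₂ : defectSpace (T 2) →L[ℂ] defectSpace (T 2)}

lemma IsFundamentalPair.norm_inner_add_norm_inner_le_one (hA : IsFundamentalPair T A₁ A₂)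
    (hT : IsEContraction T) {u : defectSpace (T 2)} (hu : ‖u‖ = 1) :
    ‖inner ℂ u (A₁ u)‖ + ‖inner ℂ u (A₂ u)‖ ≤ 1 := by
  have := hA.norm_inner_add_norm_inner_le hT u
  rwa [hu, one_pow, norm_inner_symm, norm_inner_symm (A₂ u)] at this

lemma pow_apply_tendsto_zero_of_pure (hpure : IsPureEContraction (adjointTriple T)) (h : H) :
    Filter.Tendsto (fun n : ℕ => (T 2 ^ n) h) Filter.atTop (nhds 0) := by
  simpa [adjointTriple] using hpure.pure_tendsto h

lemma omegaStarSet_inter_distBoundary_nonempty [Nontrivial H]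
    (hT : IsEContraction T) (hpure : IsPureEContraction (adjointTriple T))
    (hdim : FiniteDimensional ℂ (defectSpace (T 2))) (hA : IsFundamentalPair T A₁ A₂)
    (hcomm : A₁ * A₂ - A₂ * A₁ = 0)
    (hstar : ContinuousLinearMap.adjoint A₁ * A₁ - A₁ * ContinuousLinearMap.adjoint A₁ =
      ContinuousLinearMap.adjoint A₂ * A₂ - A₂ * ContinuousLinearMap.adjoint A₂) :
    (omegaStarSet A₁ A₂ ∩ distBoundary).Nonempty := by
  have := nontrivial_defectSpace (hT.norm_le_one 2) (pow_apply_tendsto_zero_of_pure hpure)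
  obtain ⟨e, x, hx⟩ := exists_orthonormalBasis_pencil hcomm hstar
    (fun u hu => hA.norm_inner_add_norm_inner_le_one hT hu) (z := 1) (by simp)
  exact ⟨x ⟨0, Module.finrank_pos⟩, (hx _).2⟩

lemma sum_norm_sq_evalOp_le (hT : IsEContraction T)
    (hpure : IsPureEContraction (adjointTriple T))
    (hdim : FiniteDimensional ℂ (defectSpace (T 2))) (hA : IsFundamentalPair T A₁ A₂)
    (hcomm : A₁ * A₂ - A₂ * A₁ = 0)
    (hstar : ContinuousLinearMap.adjoint A₁ * A₁ - A₁ * ContinuousLinearMap.adjoint A₁ =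
      ContinuousLinearMap.adjoint A₂ * A₂ - A₂ * ContinuousLinearMap.adjoint A₂)
    {m n : ℕ} (P : Matrix (Fin m) (Fin n) (MvPolynomial (Fin 3) ℂ)) {M : ℝ}
    (hM : ∀ x ∈ omegaStarSet A₁ A₂ ∩ distBoundary, ‖evalMatrix P x‖ ≤ M) (h : Fin n → H) :
    ∑ i, ‖∑ j, evalOp (P i j) T (h j)‖ ^ 2 ≤ M ^ 2 * ∑ j, ‖h j‖ ^ 2 := by
  have hint := hA.defectMap_apply hT.commute (hT.norm_le_one 2)
  refine sum_norm_sq_evalOp_le_of_pencil hT.commute (norm_defectMap_sq (hT.norm_le_one 2))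
    (fun h => (hint h).1) (fun h => (hint h).2) (pow_apply_tendsto_zero_of_pure hpure) P
    (fun z hz u => ?_) h
  obtain ⟨e, x, hx⟩ := exists_orthonormalBasis_pencil hcomm hstar
    (fun u hu => hA.norm_inner_add_norm_inner_le_one hT hu) hz
  exact sum_norm_sq_evalOp_le_of_orthonormalBasis P e (fun k => (hx k).1)
    (fun k => hM _ (hx k).2) u

lemma continuous_evalMatrix {m n : ℕ} (P : Matrix (Fin m) (Fin n) (MvPolynomial (Fin 3) ℂ)) :
    Continuous (evalMatrix P) :=
  continuous_matrix fun i j => MvPolynomial.continuous_eval (P i j)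

lemma norm_eval_le_norm_evalMatrix (p : MvPolynomial (Fin 3) ℂ) (x : Fin 3 → ℂ) :
    ‖evalMatrix (!![p] : Matrix (Fin 1) (Fin 1) _) x‖ ≤ ‖MvPolynomial.eval x p‖ := by
  have h : evalMatrix (!![p] : Matrix (Fin 1) (Fin 1) _) x =
      MvPolynomial.eval x p • (1 : Matrix (Fin 1) (Fin 1) ℂ) := by
    ext i j
    fin_cases i
    fin_cases j
    simp [evalMatrix]
  rw [h, norm_smul, norm_one, mul_one]

end Main

end Tetrablock

theorem theorem6p1 {H : Type*} [NormedAddCommGroup H] [InnerProductSpace ℂ H] [CompleteSpace H]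
    [Nontrivial H] (T : Fin 3 → H →L[ℂ] H)
    (hT : Tetrablock.IsEContraction T)
    (hpure : Tetrablock.IsPureEContraction (Tetrablock.adjointTriple T))
    (hdim : FiniteDimensional ℂ (Tetrablock.defectSpace (T 2)))
    (A₁ A₂ : Tetrablock.defectSpace (T 2) →L[ℂ] Tetrablock.defectSpace (T 2))
    (hA : Tetrablock.IsFundamentalPair T A₁ A₂)
    (hcomm : A₁ * A₂ - A₂ * A₁ = 0)
    (hstar : ContinuousLinearMap.adjoint A₁ * A₁ - A₁ * ContinuousLinearMap.adjoint A₁ =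
      ContinuousLinearMap.adjoint A₂ * A₂ - A₂ * ContinuousLinearMap.adjoint A₂) :
    (∀ p : MvPolynomial (Fin 3) ℂ, ∃ M : ℝ,
      IsGreatest ((fun x => ‖MvPolynomial.eval x p‖) ''
        (Tetrablock.omegaStarSet A₁ A₂ ∩ Tetrablock.distBoundary)) M ∧
      ‖Tetrablock.evalOp p T‖ ≤ M) ∧
    (∀ (m n : ℕ) (P : Matrix (Fin m) (Fin n) (MvPolynomial (Fin 3) ℂ)), ∃ M : ℝ,
      IsGreatest ((fun x => ‖Tetrablock.evalMatrix P x‖) ''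
        (Tetrablock.omegaStarSet A₁ A₂ ∩ Tetrablock.distBoundary)) M ∧
      ‖Tetrablock.evalMatrixOp P T‖ ≤ M) ∧
    ((∀ z : ℂ, ‖z‖ = 1 → Tetrablock.numericalRadius (A₁ + z • A₂) < 1) →
      Tetrablock.IsDistinguishedVariety
        (Tetrablock.omegaSet A₁ A₂ ∩ Tetrablock.tetrablock) ∧
      Tetrablock.IsDistinguishedVariety
        (Tetrablock.omegaStarSet A₁ A₂ ∩ Tetrablock.tetrablock)) := by
  have hne := Tetrablock.omegaStarSet_inter_distBoundary_nonempty hT hpure hdim hA hcomm hstar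
  have hcpt := Tetrablock.isCompact_omegaStarSet_inter_distBoundary hcomm hstar
  refine ⟨fun p => ?_, fun m n P => ?_, fun hω => ?_⟩
  · have hcont : Continuous fun x => ‖MvPolynomial.eval x p‖ :=
      (MvPolynomial.continuous_eval p).norm
    obtain ⟨M, hM⟩ := (hcpt.image hcont).exists_isGreatest (hne.image _)
    have hM0 : 0 ≤ M := by
      obtain ⟨x, -, rfl⟩ := hM.1
      exact norm_nonneg _
    refine ⟨M, hM, ContinuousLinearMap.opNorm_le_bound _ hM0 fun h => ?_⟩
    have h1 := Tetrablock.sum_norm_sq_evalOp_le hT hpure hdim hA hcomm hstar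
      (!![p] : Matrix (Fin 1) (Fin 1) _) (M := M)
      (fun x hx => (Tetrablock.norm_eval_le_norm_evalMatrix p x).trans
        (hM.2 (Set.mem_image_of_mem _ hx))) (fun _ => h)
    simp only [Fin.sum_univ_one, Matrix.of_apply, Matrix.cons_val_fin_one] at h1
    rw [← mul_pow] at h1
    exact le_of_sq_le_sq h1 (by positivity)
  · obtain ⟨M, hM⟩ := (hcpt.image (Tetrablock.continuous_evalMatrix P).norm).exists_isGreatest
      (hne.image _)
    have hM0 : 0 ≤ M := by
      obtain ⟨x, -, rfl⟩ := hM.1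
      exact norm_nonneg _
    exact ⟨M, hM, Tetrablock.norm_blockOp_le hM0
      (Tetrablock.sum_norm_sq_evalOp_le hT hpure hdim hA hcomm hstar P
        fun x hx => hM.2 (Set.mem_image_of_mem _ hx))⟩
  · have hlt := fun (u : Tetrablock.defectSpace (T 2)) (hu : ‖u‖ = 1) =>
      Tetrablock.norm_inner_add_norm_inner_lt_one hω hu
    refine ⟨?_, Tetrablock.isDistinguishedVariety_omegaStarSet hcomm hstar hlt⟩
    -- Passing to adjoints exchanges the two sets, preserves the commutator hypotheses, and leaves
    -- the moduli `|⟨Aᵢ u, u⟩|` unchanged.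
    have hΩ : Tetrablock.omegaSet A₁ A₂ = Tetrablock.omegaStarSet
        (ContinuousLinearMap.adjoint A₁) (ContinuousLinearMap.adjoint A₂) := by
      simp only [Tetrablock.omegaSet, Tetrablock.omegaStarSet,
        ContinuousLinearMap.adjoint_adjoint]
    rw [hΩ]
    refine Tetrablock.isDistinguishedVariety_omegaStarSet ?_ ?_ fun u hu => ?_
    · exact Tetrablock.adjoint_commutator_eq_zero hcomm
    · simp only [ContinuousLinearMap.adjoint_adjoint]
      rw [← neg_sub, hstar, neg_sub]
    · rw [ContinuousLinearMap.adjoint_inner_right, ContinuousLinearMap.adjoint_inner_right,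
        norm_inner_symm, norm_inner_symm (A₂ u)]
      exact hlt u hu
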